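/- **Conventions.** Virtual knots are oriented: equivalence classes of virtual knot diagrams (with classical and virtual crossings) modulo generalized Reidemeister moves; equivalently, equivalence classes of signed Gauss words modulo change of base point, renaming of crossings and the three Reidemeister moves. A signed Gauss word lists, along the knot from a base point, the passages through the classical crossings, each marked as over ($O$) or under ($U$) and with the sign of the crossing. An *arc shift* takes an arc of a diagram that passes exactly two consecutive crossings (each classical or virtual), cuts it at both ends and reglues it with its ends switched, all new crossings being virtual; in the Gauss word, the at most two consecutive classical passages of the arc are reversed in order, and the sign of a classical crossing is reversed once for every passage of the arc through it. The distance $d_A(K,K')$ is the least number of arc shifts that, together with generalized Reidemeister moves, convert a diagram of $K$ into a diagram of $K'$. The Gordian complex $\mathcal G_A$ has all virtual knots as vertices, and $n+1$ distinct virtual knots $K_0,\dots,K_n$ span an $n$-simplex if and only if $d_A(K_i,K_j)=1$ for all $i\ne j$. Let $VK_0$ be the unknot, with the empty Gauss word. For $n\ge 1$ let $VK_n$ be the diagram with classical crossings $c_0^5,c_0^6$ and $c_i^1,\dots,c_i^6$ ($1\le i\le n$), of which all $c_i^2$ and $c_i^3$ are negative and all others positive, and with the Gauss word $$U(c_0^5)\,U(c_0^6)\,U(c_1^1)\,U(c_1^3)\,O(c_0^6)\,O(c_0^5)\;B_n\,B_{n-1}\cdots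 B_1,$$ $$B_i=U(c_i^6)\,U(c_i^5)\,O(c_i^2)\,O(c_i^1)\,O(c_i^5)\,O(c_i^6)\,O(c_i^3)\,O(c_i^4)\;\,R_i\;\,U(c_i^4)\,U(c_i^2),$$ where $R_i=U(c_{i+1}^1)\,U(c_{i+1}^3)$ for $i<n$ and $R_n$ is empty. For diagrams $D,D'$ with base points, $D\# D'$ denotes the connected sum at the base points, whose Gauss word is the concatenation of those of $D$ and $D'$ (with the crossings of $D$ and $D'$ kept distinct). **Corollary.** Let $L$ be a virtual knot, i.e. a $0$-simplex of $\mathcal G_A$, and let $n\ge 1$. Then $L$ is a vertex of some $n$-simplex of $\mathcal G_A$. More precisely, for every diagram $D$ of $L$ and every base point on $D$, the virtual knots represented by $$D\#VK_0,\;D\#VK_1,\;\dots,\;D\#VK_n$$ are $n+1$ distinct vertices which span an $n$-simplex of $\mathcal G_A$, and $D\#VK_0$ represents $L$. -/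

import Mathlib

/-!
Virtual knots, presented by signed Gauss words, and the arc shift move.

Running once along an oriented virtual knot diagram from a base point and recording the classical
crossings met, each with over/under information and with its sign, gives a signed Gauss word.
Planar virtual diagrams modulo the generalized Reidemeister moves are the same as signed Gauss
words modulo change of base point, renaming of the crossings and the three classical Reidemeister
moves; virtual crossings are not recorded, and the purely virtual and the mixed moves do not change
the Gauss word. All virtual knots are oriented.
-/

/-- A passage of the knot through a classical crossing: the name of the crossing, whether the
passage is the upper one, and whether the crossing is positive. -/
@[ext]
structure GaussLetter where
  crossing : ℕ
  isOver : Bool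
  isPos : Bool
deriving DecidableEq

namespace GaussLetter

/-- The other passage through the same crossing. -/
def mate (x : GaussLetter) : GaussLetter := { x with isOver := !x.isOver }

/-- The same passage after the sign of its crossing has been reversed. -/
def flipSign (x : GaussLetter) : GaussLetter := { x with isPos := !x.isPos }

/-- Rename the crossing. -/
def rename (f : ℕ → ℕ) (x : GaussLetter) : GaussLetter := { x with crossing := f x.crossing }

end GaussLetter

/-- `w` is a signed Gauss word: every crossing that occurs in it is passed exactly twice, once over
and once under, and the two passages carry the same sign. -/
structure IsGaussWord (w : List GaussLetter) : Prop where
  nodup : w.Nodup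
  mate_mem : ∀ x ∈ w, x.mate ∈ w
  eq_or_eq_mate : ∀ x ∈ w, ∀ y ∈ w, y.crossing = x.crossing → y = x ∨ y = x.mate

/-- A diagram of an oriented virtual knot with a base point, given by its signed Gauss word.
The empty word is the diagram of the unknot without classical crossings. -/
structure GaussDiagram where
  word : List GaussLetter
  isGaussWord : IsGaussWord word

/-- Two passages through distinct crossings in the order `x, y` if `e` is `true`, and in the order
`y, x` otherwise. -/
def orderedPair (e : Bool) (x y : GaussLetter) : List GaussLetter :=
  if e then [x, y] else [y, x]

/-- Elementary steps between Gauss words that do not change the virtual knot. Since the base point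
can be moved, each Reidemeister move need only be stated with one of its strands at the beginning
of the word. -/
inductive ReidemeisterStep : List GaussLetter → List GaussLetter → Prop
  /-- Moving the base point. -/
  | rotate (u v : List GaussLetter) : ReidemeisterStep (u ++ v) (v ++ u)
  /-- Renaming the crossings. -/
  | rename (f : ℕ → ℕ) (hf : Function.Injective f) (w : List GaussLetter) :
      ReidemeisterStep w (w.map (GaussLetter.rename f))
  /-- First move: a kink is removed. -/
  | r1 (x : GaussLetter) (w : List GaussLetter) :
      ReidemeisterStep ([x, x.mate] ++ w) w
  /-- Second move: two crossings of opposite sign are removed; one strand passes both of them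
  consecutively on the same level, the other strand passes both of them consecutively on the other
  level. The strands may be parallel (`e = true`) or antiparallel (`e = false`). -/
  | r2 (e : Bool) (x y : GaussLetter) (u v : List GaussLetter)
      (hlevel : x.isOver = y.isOver) (hsign : x.isPos ≠ y.isPos) :
      ReidemeisterStep ([x, y] ++ u ++ orderedPair e x.mate y.mate ++ v) (u ++ v)
  /-- Third move, for a triangle with crossings `a` (top over middle strand), `b` (top over bottom
  strand) and `c` (middle over bottom strand), the strands being met in the cyclic order top,
  middle, bottom. The booleans `eT`, `eM`, `eB` tell whether the top strand passes `a` before `b`,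
  the middle strand `a` before `c`, the bottom strand `b` before `c`. The two conditions are those
  under which the strands bound a triangle in the plane: for three lines in the plane with
  directions `t, m, b` one has `sign a = t × m`, `sign b = t × b`, `sign c = m × b`. -/
  | r3 (a b c : GaussLetter) (eT eM eB : Bool) (u v w : List GaussLetter)
      (ha : a.isOver = true) (hb : b.isOver = true) (hc : c.isOver = true)
      (h₁ : (eB = b.isPos) ↔ (eM = a.isPos)) (h₂ : (eB = c.isPos) ↔ (eT = a.isPos)) :
      ReidemeisterStep
        (orderedPair eT a b ++ u ++ orderedPair eM a.mate c ++ v ++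
          orderedPair eB b.mate c.mate ++ w)
        (orderedPair (!eT) a b ++ u ++ orderedPair (!eM) a.mate c ++ v ++
          orderedPair (!eB) b.mate c.mate ++ w)
  /-- Third move, the strands being met in the cyclic order top, bottom, middle. -/
  | r3' (a b c : GaussLetter) (eT eM eB : Bool) (u v w : List GaussLetter)
      (ha : a.isOver = true) (hb : b.isOver = true) (hc : c.isOver = true)
      (h₁ : (eB = b.isPos) ↔ (eM = a.isPos)) (h₂ : (eB = c.isPos) ↔ (eT = a.isPos)) :
      ReidemeisterStep
        (orderedPair eT a b ++ u ++ orderedPair eB b.mate c.mate ++ v ++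
          orderedPair eM a.mate c ++ w)
        (orderedPair (!eT) a b ++ u ++ orderedPair (!eB) b.mate c.mate ++ v ++
          orderedPair (!eM) a.mate c ++ w)

/-- Two diagrams are equivalent if they are joined by finitely many elementary steps, each in
either direction, all intermediate words being Gauss words. -/
def gaussDiagramSetoid : Setoid GaussDiagram :=
  Relation.EqvGen.setoid fun D D' => ReidemeisterStep D.word D'.word

/-- Oriented virtual knots. -/
def VirtualKnot : Type := Quotient gaussDiagramSetoid

/-- The virtual knot represented by a diagram. -/
def GaussDiagram.knot (D : GaussDiagram) : VirtualKnot := Quotient.mk gaussDiagramSetoid D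

/-- The effect on a passage `x` of reversing the segment `s` of the knot: the sign of the crossing
of `x` is reversed once for every passage of `s` through this crossing. -/
def GaussLetter.flipAlong (s : List GaussLetter) (x : GaussLetter) : GaussLetter :=
  if Odd (s.countP fun y => y.crossing = x.crossing) then x.flipSign else x

/-- `D'` arises from `D` by an arc shift. An arc is a segment of the knot that passes exactly two
consecutive crossings, each of them classical or virtual; `s` lists its passages through classical
crossings, of which there are two, one or none. (By a move that creates virtual crossings, any one
classical passage can be given a virtual neighbour.) The arc is cut at both ends and
glued back with its ends switched, so it is now traversed backwards, and all new crossings are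
virtual. Hence `s` is reversed and the classical crossings through which the arc passes change
their sign, while over/under stays. -/
def ArcShift (D D' : GaussDiagram) : Prop :=
  ∃ s u : List GaussLetter, s.length ≤ 2 ∧ D.word.IsRotated (s ++ u) ∧
    D'.word.IsRotated ((s.reverse ++ u).map (GaussLetter.flipAlong s))

/-- Some diagram of `K` is turned into some diagram of `K'` by a single arc shift. -/
def ArcShiftAdj (K K' : VirtualKnot) : Prop :=
  ∃ D D' : GaussDiagram, D.knot = K ∧ D'.knot = K' ∧ ArcShift D D'

/-- The arc shift distance: the least number of arc shifts needed, together with generalized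
Reidemeister moves, to convert a diagram of `K` into a diagram of `K'` (`⊤` if this is
impossible). -/
noncomputable def arcShiftDist (K K' : VirtualKnot) : ℕ∞ :=
  ⨅ (m : ℕ) (_ : ∃ c : ℕ → VirtualKnot, c 0 = K ∧ c m = K' ∧
    ∀ i < m, ArcShiftAdj (c i) (c (i + 1))), (m : ℕ∞)

/-- The Gordian complex of virtual knots by arc shifts: the vertices are all virtual knots, and a
nonempty finite set of virtual knots is a simplex iff any two distinct members have arc shift
distance one. -/
def arcShiftGordianComplex : AbstractSimplicialComplex VirtualKnot where
  faces := {σ | σ.Nonempty ∧ ∀ K ∈ σ, ∀ K' ∈ σ, K ≠ K' → arcShiftDist K K' = 1}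
  isRelLowerSet_faces := by
    intro σ hσ
    refine ⟨hσ.1, fun τ hτ hne => ⟨hne, fun K hK K' hK' h => ?_⟩⟩
    exact hσ.2 K (hτ hK) K' (hτ hK') h
  singleton_mem := by
    intro K
    refine ⟨Finset.singleton_nonempty K, fun K₁ h₁ K₂ h₂ h => ?_⟩
    rw [Finset.mem_singleton] at h₁ h₂
    exact absurd (h₁.trans h₂.symm) h

/-- `σ` is an `n`-simplex of the complex `X`. -/
def IsSimplexOfDim {V : Type*} (X : AbstractSimplicialComplex V) (n : ℕ) (σ : Finset V) : Prop :=
  σ ∈ X.faces ∧ σ.card = n + 1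

section ConnectedSum

theorem GaussLetter.rename_injective {f : ℕ → ℕ} (hf : Function.Injective f) :
    Function.Injective (GaussLetter.rename f) := by
  intro x y h
  simp only [GaussLetter.rename, GaussLetter.mk.injEq] at h
  exact GaussLetter.ext (hf h.1) h.2.1 h.2.2

theorem IsGaussWord.rename {w : List GaussLetter} (hw : IsGaussWord w) {f : ℕ → ℕ}
    (hf : Function.Injective f) : IsGaussWord (w.map (GaussLetter.rename f)) where
  nodup := hw.nodup.map (GaussLetter.rename_injective hf)
  mate_mem := by
    intro x hx
    obtain ⟨y, hy, rfl⟩ := List.mem_map.1 hx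
    exact List.mem_map.2 ⟨y.mate, hw.mate_mem y hy, rfl⟩
  eq_or_eq_mate := by
    intro x hx y hy h
    obtain ⟨x, hx₀, rfl⟩ := List.mem_map.1 hx
    obtain ⟨y, hy₀, rfl⟩ := List.mem_map.1 hy
    rcases hw.eq_or_eq_mate x hx₀ y hy₀ (hf h) with rfl | rfl
    · exact Or.inl rfl
    · exact Or.inr rfl

theorem IsGaussWord.append {w w' : List GaussLetter} (hw : IsGaussWord w) (hw' : IsGaussWord w')
    (h : ∀ x ∈ w, ∀ y ∈ w', x.crossing ≠ y.crossing) : IsGaussWord (w ++ w') where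
  nodup := List.nodup_append.2 ⟨hw.nodup, hw'.nodup, fun x hx y hy e => h x hx y hy (by rw [e])⟩
  mate_mem := by
    intro x hx
    rcases List.mem_append.1 hx with hx | hx
    · exact List.mem_append.2 (Or.inl (hw.mate_mem x hx))
    · exact List.mem_append.2 (Or.inr (hw'.mate_mem x hx))
  eq_or_eq_mate := by
    intro x hx y hy e
    rcases List.mem_append.1 hx with hx | hx <;> rcases List.mem_append.1 hy with hy | hy
    · exact hw.eq_or_eq_mate x hx y hy e
    · exact absurd e.symm (h x hx y hy)
    · exact absurd e (h y hy x hx)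
    · exact hw'.eq_or_eq_mate x hx y hy e

/-- The connected sum of two diagrams at their base points: both knots are cut there and glued
along their orientations. The crossings are renamed so that those of the two summands stay
distinct. -/
def GaussDiagram.connectedSum (D D' : GaussDiagram) : GaussDiagram where
  word := D.word.map (GaussLetter.rename fun k => 2 * k) ++
    D'.word.map (GaussLetter.rename fun k => 2 * k + 1)
  isGaussWord := by
    refine IsGaussWord.append (D.isGaussWord.rename fun a b h => ?_)
      (D'.isGaussWord.rename fun a b h => ?_) ?_
    · simpa using h
    · simpa using h
    · intro x hx y hy
      obtain ⟨x, -, rfl⟩ := List.mem_map.1 hx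
      obtain ⟨y, -, rfl⟩ := List.mem_map.1 hy
      simp only [GaussLetter.rename]
      omega

end ConnectedSum

section VK

/-- Signs of the classical crossings of `VK n`: of the crossings `1, …, 6` of a block, those with
number `2` or `3` are negative, the others positive. -/
def vkSign (k : ℕ) : Bool := !(k == 2 || k == 3)

/-- The upper passage through the `k`-th classical crossing of the `i`-th block of `VK n`. -/
def vkO (i k : ℕ) : GaussLetter := ⟨6 * i + k, true, vkSign k⟩

/-- The lower passage through the `k`-th classical crossing of the `i`-th block of `VK n`. -/
def vkU (i k : ℕ) : GaussLetter := ⟨6 * i + k, false, vkSign k⟩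

/-- The part of the knot in the `i`-th block (`i ≥ 1`) that runs through the twisted band (with
crossings `5`, `6`) and around the vertical strands (crossings `1`, `2`, `3`, `4`). -/
def vkBand (i : ℕ) : List GaussLetter :=
  [vkU i 6, vkU i 5, vkO i 2, vkO i 1, vkO i 5, vkO i 6, vkO i 3, vkO i 4]

/-- The part of the knot which starts on the lowest horizontal line, runs from there to the far
right and back through the blocks `i + m, i + m - 1, …, i`, and leaves block `i` to the left on the
highest horizontal line. -/
def vkTail : ℕ → ℕ → List GaussLetter
  | i, 0 => vkBand i ++ [vkU i 4, vkU i 2]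
  | i, m + 1 =>
    vkTail (i + 1) m ++ vkBand i ++ [vkU (i + 1) 1, vkU (i + 1) 3] ++ [vkU i 4, vkU i 2]

/-- The Gauss word of `VK n`, with base point on the outer left arc of block `0`. Block `0`
consists of a twisted band only, with classical crossings `5` and `6`. -/
def vkWord : ℕ → List GaussLetter
  | 0 => []
  | n + 1 =>
    [vkU 0 5, vkU 0 6] ++ [vkU 1 1, vkU 1 3] ++ [vkO 0 6, vkO 0 5] ++ vkTail 1 n

/-- Both passages through each of the six crossings of block `i`. -/
def vkBlockLetters (i : ℕ) : List GaussLetter :=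
  [vkO i 1, vkU i 1, vkO i 2, vkU i 2, vkO i 3, vkU i 3,
    vkO i 4, vkU i 4, vkO i 5, vkU i 5, vkO i 6, vkU i 6]

/-- Both passages through each of the crossings of the blocks `i, …, i + m`. -/
def vkLetters : ℕ → ℕ → List GaussLetter
  | i, 0 => vkBlockLetters i
  | i, m + 1 => vkBlockLetters i ++ vkLetters (i + 1) m

theorem vkTail_perm (m : ℕ) : ∀ i : ℕ,
    ([vkU i 1, vkU i 3] ++ vkTail i m).Perm (vkLetters i m) := by
  induction m with
  | zero =>
    intro i
    rw [List.perm_iff_count]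
    intro a
    simp only [vkTail, vkLetters, vkBand, vkBlockLetters, List.count_append, List.count_cons,
      List.count_nil]
    omega
  | succ m ih =>
    intro i
    rw [List.perm_iff_count]
    intro a
    have h := (List.perm_iff_count.1 (ih (i + 1))) a
    simp only [vkTail, vkLetters, vkBand, vkBlockLetters, List.count_append, List.count_cons,
      List.count_nil] at h ⊢
    omega

theorem vkBlockLetters_isGaussWord (i : ℕ) : IsGaussWord (vkBlockLetters i) := by
  have h0 : IsGaussWord (vkBlockLetters 0) := ⟨by decide, by decide, by decide⟩
  have h := h0.rename (f := fun k => 6 * i + k) fun a b h => by simpa using h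
  simpa [vkBlockLetters, vkO, vkU, GaussLetter.rename] using h

theorem vkBlockLetters_crossing (i : ℕ) : ∀ x ∈ vkBlockLetters i,
    6 * i < x.crossing ∧ x.crossing ≤ 6 * i + 6 := by
  intro x hx
  simp only [vkBlockLetters, List.mem_cons, List.not_mem_nil, or_false] at hx
  rcases hx with h | h | h | h | h | h | h | h | h | h | h | h <;>
    (subst h; simp [vkO, vkU])

theorem vkLetters_isGaussWord (m : ℕ) : ∀ i : ℕ, IsGaussWord (vkLetters i m) ∧
    ∀ x ∈ vkLetters i m, 6 * i < x.crossing := by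
  induction m with
  | zero => exact fun i => ⟨vkBlockLetters_isGaussWord i, fun x hx => (vkBlockLetters_crossing i x hx).1⟩
  | succ m ih =>
    intro i
    obtain ⟨h1, h2⟩ := ih (i + 1)
    refine ⟨(vkBlockLetters_isGaussWord i).append h1 fun x hx y hy => ?_, fun x hx => ?_⟩
    · have := (vkBlockLetters_crossing i x hx).2
      have := h2 y hy
      omega
    · rcases List.mem_append.1 hx with hx | hx
      · exact (vkBlockLetters_crossing i x hx).1
      · have := h2 x hx
        omega

theorem IsGaussWord.perm {w w' : List GaussLetter} (hw : IsGaussWord w) (h : w.Perm w') :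
    IsGaussWord w' where
  nodup := h.nodup_iff.1 hw.nodup
  mate_mem := fun x hx => h.mem_iff.1 (hw.mate_mem x (h.mem_iff.2 hx))
  eq_or_eq_mate := fun x hx y hy => hw.eq_or_eq_mate x (h.mem_iff.2 hx) y (h.mem_iff.2 hy)

theorem vkWord_isGaussWord : ∀ n : ℕ, IsGaussWord (vkWord n)
  | 0 => ⟨by decide, by decide, by decide⟩
  | n + 1 => by
    have h0 : IsGaussWord [vkO 0 5, vkU 0 5, vkO 0 6, vkU 0 6] :=
      ⟨by decide, by decide, by decide⟩
    obtain ⟨h1, h2⟩ := vkLetters_isGaussWord n 1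
    refine (h0.append h1 fun x hx y hy => ?_).perm ?_
    · have h3 := h2 y hy
      simp only [List.mem_cons, List.not_mem_nil, or_false] at hx
      rcases hx with h | h | h | h <;> (subst h; simp only [vkO, vkU]; omega)
    · rw [List.perm_iff_count]
      intro a
      have h := (List.perm_iff_count.1 (vkTail_perm n 1)) a
      simp only [vkWord, List.count_append, List.count_cons, List.count_nil] at h ⊢
      omega

/-- The diagram `VK n`: it consists of blocks `0, 1, …, n`, each containing a twisted band of two
strands with two classical and two virtual crossings in alternation. `VK 0` is the unknot. -/
def vkDiagram (n : ℕ) : GaussDiagram := ⟨vkWord n, vkWord_isGaussWord n⟩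

end VK

open scoped Classical in
/-- The virtual knots represented by the connected sums `D # VK 0, …, D # VK n`. -/
noncomputable def vkSumVertices (D : GaussDiagram) (n : ℕ) : Finset VirtualKnot :=
  (Finset.range (n + 1)).image fun i => (D.connectedSum (vkDiagram i)).knot

/-!
The knots `D # VK 0, …, D # VK n` are pairwise one arc shift apart, and they are told apart by an
integer-valued invariant of virtual knots, the chain count.

*Distance.* Reversing the sign of crossing `5` of block `m + 1` of `VK n`, `m < n`, is an arc shift
of an arc with a single classical passage. After it the two crossings `5`, `6` of this block cancel
by a second Reidemeister move; then the crossings `1`, `3` and the crossings `2`, `4` of the block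
cancel as well, and the later blocks come apart one after the other by first and second
Reidemeister moves (`vkTail_reduces`). What is left is `VK m` (`vkWord_flip_reduces`). All these
moves take place in the summand `VK n`, so they can be made in `D # VK n`.

*Distinction.* A virtual knot lives on a closed surface, and every crossing `c` cuts off a loop that
runs from the upper passage through `c` to the lower one. The intersection numbers of these loops
with the knot and with each other can be read off from the Gauss word (`loopIndex`, `loopInter`);
they are preserved by a third Reidemeister move, the two crossings of a second move have opposite
signs and equal intersection numbers, and the loop of a kink is homologous to zero or to the whole
knot, hence has intersection number `0` with the knot. Hence, for every `k`, the following number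
is an invariant (`chainCount_eq_of_knot_eq`): among the crossings whose loop has intersection number
`-2` with the knot, count the chains `c₀, …, cₖ` in which the loops of consecutive crossings have
intersection number `-2`, each chain with the product of the signs of its members.

For `VK n` the crossings `1` of the blocks `2, …, n` (positive) and the crossings `2` of the blocks
`1, …, n` (negative) have loops of the required kind, and a chain descends from crossing `1` of one
block to crossing `1` or `2` of the preceding block. The contributions of the two crossings of a
block cancel, except at the lower end of the chain in block `1`, so that the `k`-th chain count is
`-1` if `k < n` and `0` otherwise (`vkWord_chainCount`). In `D # VK n` a chain can pass from `D` to
`VK n`, but not back, so the chains that start in `D` see `VK n` only through its chain counts of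
lower order. Since those of `VK m` and `VK n` with `m < n` agree below order `m` and differ in order
`m`, the same holds for the two connected sums (`chainCount_append_sub`).
-/

/-! ### Relative positions of the letters of a word -/

namespace GaussLetter

/-- The sign `±1` of the crossing of a passage. -/
def sgn (x : GaussLetter) : ℤ := if x.isPos then 1 else -1

/-- The sign of the crossing for an upper passage, its negative for a lower one. -/
def charge (x : GaussLetter) : ℤ := if x.isOver = x.isPos then 1 else -1

@[simp] theorem mate_mate (x : GaussLetter) : x.mate.mate = x := by
  cases x; simp [mate]

theorem mate_ne (x : GaussLetter) : x.mate ≠ x := by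
  intro h
  have := congrArg GaussLetter.isOver h
  simp [mate] at this

theorem mate_injective : Function.Injective mate :=
  Function.Involutive.injective mate_mate

@[simp] theorem mate_inj {x y : GaussLetter} : x.mate = y.mate ↔ x = y :=
  mate_injective.eq_iff

@[simp] theorem mate_isOver (x : GaussLetter) : x.mate.isOver = !x.isOver := rfl

@[simp] theorem mate_isPos (x : GaussLetter) : x.mate.isPos = x.isPos := rfl

@[simp] theorem mate_crossing (x : GaussLetter) : x.mate.crossing = x.crossing := rfl

@[simp] theorem charge_mate (x : GaussLetter) : x.mate.charge = -x.charge := by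
  rcases x with ⟨c, _ | _, _ | _⟩ <;> simp [mate, charge]

theorem charge_of_isOver {x : GaussLetter} (h : x.isOver = true) : x.charge = x.sgn := by
  rcases x with ⟨c, _ | _, _ | _⟩ <;> simp_all [charge, sgn]

@[simp] theorem rename_mate (f : ℕ → ℕ) (x : GaussLetter) :
    (x.rename f).mate = x.mate.rename f := rfl

@[simp] theorem rename_charge (f : ℕ → ℕ) (x : GaussLetter) :
    (x.rename f).charge = x.charge := rfl

@[simp] theorem rename_sgn (f : ℕ → ℕ) (x : GaussLetter) : (x.rename f).sgn = x.sgn := rfl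

@[simp] theorem rename_isOver (f : ℕ → ℕ) (x : GaussLetter) :
    (x.rename f).isOver = x.isOver := rfl

end GaussLetter

/-- The position of `x` relative to `y` in the word `w`: `0` if `x` comes before `y`, `2` if it
comes after `y`, and `1` if they are equal. -/
def side (w : List GaussLetter) (x y : GaussLetter) : ℤ :=
  if w.idxOf x < w.idxOf y then 0 else if w.idxOf y < w.idxOf x then 2 else 1

@[simp] theorem side_self (w : List GaussLetter) (x : GaussLetter) : side w x x = 1 := by
  simp [side]

theorem side_swap (w : List GaussLetter) (x y : GaussLetter) :
    side w y x = 2 - side w x y := by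
  unfold side
  split_ifs <;> omega

section Side

variable {w u v : List GaussLetter} {x y z : GaussLetter}

theorem side_append_left (hx : x ∈ u) (hy : y ∈ u) : side (u ++ v) x y = side u x y := by
  simp [side, List.idxOf_append_of_mem, hx, hy]

theorem side_append_right (hx : x ∉ u) (hy : y ∉ u) : side (u ++ v) x y = side v x y := by
  simp [side, List.idxOf_append_of_notMem, hx, hy]

theorem side_append_lt (hx : x ∈ u) (hy : y ∉ u) : side (u ++ v) x y = 0 := by
  have := List.idxOf_lt_length_of_mem hx
  simp only [side, List.idxOf_append_of_mem hx, List.idxOf_append_of_notMem hy]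
  rw [if_pos (by omega)]

theorem side_append_gt (hx : x ∉ u) (hy : y ∈ u) : side (u ++ v) x y = 2 := by
  rw [side_swap, side_append_lt hy hx]; rfl

theorem side_map {f : GaussLetter → GaussLetter} (hf : Function.Injective f)
    (w : List GaussLetter) (x y : GaussLetter) : side (w.map f) (f x) (f y) = side w x y := by
  have h : ∀ x, (w.map f).idxOf (f x) = w.idxOf x := by
    intro x
    induction w with
    | nil => rfl
    | cons a l ih =>
      by_cases hax : a = x
      · subst hax; simp
      · rw [List.map_cons, List.idxOf_cons_ne _ (fun h => hax (hf h)), List.idxOf_cons_ne _ hax, ih]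
  simp [side, h]

/-- Deleting letters does not change the relative position of the other letters. -/
theorem side_sublist (h : u.Sublist w) (hw : w.Nodup) (hx : x ∈ u) (hy : y ∈ u) :
    side u x y = side w x y := by
  induction h with
  | slnil => simp at hx
  | @cons l₁ l₂ a h ih =>
    have ha := (List.nodup_cons.1 hw).1
    have hxa : x ≠ a := fun e => ha (e ▸ h.subset hx)
    have hya : y ≠ a := fun e => ha (e ▸ h.subset hy)
    rw [ih (List.nodup_cons.1 hw).2 hx hy]
    exact (side_append_right (u := [a]) (by simpa using hxa) (by simpa using hya)).symm
  | @cons_cons l₁ l₂ a h ih =>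
    have hw' := (List.nodup_cons.1 hw).2
    change side ([a] ++ l₁) x y = side ([a] ++ l₂) x y
    by_cases hxa : x = a <;> by_cases hya : y = a
    · simp [hxa, hya]
    · rw [side_append_lt (by simpa using hxa) (by simpa using hya),
        side_append_lt (by simpa using hxa) (by simpa using hya)]
    · rw [side_append_gt (by simpa using hxa) (by simpa using hya),
        side_append_gt (by simpa using hxa) (by simpa using hya)]
    · rw [side_append_right (by simpa using hxa) (by simpa using hya),
        side_append_right (by simpa using hxa) (by simpa using hya)]
      exact ih hw' ((List.mem_cons.1 hx).resolve_left hxa) ((List.mem_cons.1 hy).resolve_left hya)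

/-- The relative positions are given by any labelling that increases along the word. -/
theorem side_of_pairwise_lt {q : GaussLetter → ℤ} (h : w.Pairwise fun x y => q x < q y)
    (hx : x ∈ w) (hy : y ∈ w) :
    side w x y = if q x < q y then 0 else if q y < q x then 2 else 1 := by
  induction w with
  | nil => simp at hx
  | cons a l ih =>
    obtain ⟨h1, h2⟩ := List.pairwise_cons.1 h
    have key : ∀ z ∈ l, z ≠ a := fun z hz e => by have := h1 z hz; rw [e] at this; omega
    change side ([a] ++ l) x y = _
    rcases List.mem_cons.1 hx with hxa | hxl <;> rcases List.mem_cons.1 hy with hya | hyl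
    · subst hxa; subst hya; simp
    · rw [side_append_lt (by simpa using hxa) (by simpa using key y hyl), if_pos]
      rw [hxa]; exact h1 y hyl
    · rw [side_append_gt (by simpa using key x hxl) (by simpa using hya), if_neg, if_pos]
      · rw [hya]; exact h1 x hxl
      · rw [hya]; exact (h1 x hxl).le.not_gt
    · rw [side_append_right (by simpa using key x hxl) (by simpa using key y hyl)]
      exact ih h2 hxl hyl

theorem notMem_of_nodup_pair (h : (u ++ [x, y] ++ v).Nodup) : x ∉ u ∧ y ∉ u ∧ x ≠ y := by
  have h1 := List.nodup_append.1 (List.nodup_append.1 h).1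
  refine ⟨fun hx => h1.2.2 x hx x (by simp) rfl, fun hy => h1.2.2 y hy y (by simp) rfl, ?_⟩
  simpa using h1.2.1

theorem side_pair (h : (u ++ [x, y] ++ v).Nodup) : side (u ++ [x, y] ++ v) x y = 0 := by
  obtain ⟨hx, hy, hxy⟩ := notMem_of_nodup_pair h
  rw [List.append_assoc, side_append_right hx hy]
  exact side_append_lt (u := [x]) (by simp) (by simpa using hxy.symm)

/-- No letter lies between two neighbours. -/
theorem side_neighbours (h : (u ++ [x, y] ++ v).Nodup) (hx : z ≠ x) (hy : z ≠ y) :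
    side (u ++ [x, y] ++ v) x z = side (u ++ [x, y] ++ v) y z := by
  obtain ⟨h1, h2, -⟩ := notMem_of_nodup_pair h
  by_cases hz : z ∈ u
  · rw [List.append_assoc, side_append_gt h1 hz, side_append_gt h2 hz]
  · rw [List.append_assoc, side_append_right h1 hz, side_append_right h2 hz,
      side_append_lt (by simp) (by simp [hx, hy]), side_append_lt (by simp) (by simp [hx, hy])]

/-- The change of relative positions when the neighbours `x`, `y` are exchanged. -/
def exchangeSide (x y s t : GaussLetter) : ℤ :=
  2 * ((if s = x then 1 else 0) * (if t = y then 1 else 0) -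
    (if s = y then 1 else 0) * (if t = x then 1 else 0))

/-- Exchanging two neighbours only changes their relative position. -/
theorem side_exchange (h : (u ++ [x, y] ++ v).Nodup) (s t : GaussLetter) :
    side (u ++ [y, x] ++ v) s t = side (u ++ [x, y] ++ v) s t +
      exchangeSide x y s t := by
  obtain ⟨h1, h2, h3⟩ := notMem_of_nodup_pair h
  have hpair : ∀ s t, side [y, x] s t = side [x, y] s t +
      exchangeSide x y s t := by
    intro s t
    simp only [exchangeSide, side, List.idxOf_cons, List.idxOf_nil, beq_iff_eq, cond_eq_ite]
    by_cases a : x = s <;> by_cases b : x = t <;> by_cases c : y = s <;> by_cases d : y = t <;>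
      simp_all [eq_comm]
  have hmem : ∀ r, r ∈ [y, x] ↔ r ∈ [x, y] := by intro r; simp [or_comm]
  rw [List.append_assoc, List.append_assoc]
  by_cases hs : s ∈ u <;> by_cases ht : t ∈ u
  · have e1 : s ≠ x := fun e => h1 (e ▸ hs)
    have e2 : s ≠ y := fun e => h2 (e ▸ hs)
    simp [side_append_left hs ht, exchangeSide, e1, e2]
  · have e1 : s ≠ x := fun e => h1 (e ▸ hs)
    have e2 : s ≠ y := fun e => h2 (e ▸ hs)
    simp [side_append_lt hs ht, exchangeSide, e1, e2]
  · have e1 : t ≠ x := fun e => h1 (e ▸ ht)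
    have e2 : t ≠ y := fun e => h2 (e ▸ ht)
    simp [side_append_gt hs ht, exchangeSide, e1, e2]
  · rw [side_append_right hs ht, side_append_right hs ht]
    by_cases hs' : s ∈ [x, y] <;> by_cases ht' : t ∈ [x, y]
    · rw [side_append_left hs' ht', side_append_left ((hmem s).2 hs') ((hmem t).2 ht')]
      exact hpair s t
    · rw [side_append_lt hs' ht', side_append_lt ((hmem s).2 hs') (mt (hmem t).1 ht')]
      simp only [List.mem_cons, List.not_mem_nil, or_false, not_or] at ht'
      simp [exchangeSide, ht']
    · rw [side_append_gt hs' ht', side_append_gt (mt (hmem s).1 hs') ((hmem t).2 ht')]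
      simp only [List.mem_cons, List.not_mem_nil, or_false, not_or] at hs'
      simp [exchangeSide, hs']
    · rw [side_append_right hs' ht',
        side_append_right (mt (hmem s).1 hs') (mt (hmem t).1 ht')]
      simp only [List.mem_cons, List.not_mem_nil, or_false, not_or] at hs'
      simp [exchangeSide, hs']

end Side

/-! ### Intersection numbers of loops and chain counts -/

/-- The loop of the crossing of `e` runs from the passage `e` along the knot to the other passage.
`loopWeight w e x` is `2` if `x` lies in the interior of this loop, `1` if it is one of its two
ends and `0` otherwise. The last summand makes it independent of the base point. -/
def loopWeight (w : List GaussLetter) (e x : GaussLetter) : ℤ :=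
  side w x e - side w x e.mate + side w e e.mate

/-- The bilinear form on functions on the letters of `w` that counts, with signs, the crossings of
one part of the knot with another. It is skew-symmetric if `w` is a Gauss word. -/
def pairing (w : List GaussLetter) (φ ψ : GaussLetter → ℤ) : ℤ :=
  (w.map fun x => x.charge * φ x * ψ x.mate).sum

/-- Twice the intersection number of the whole knot with the loop of `e`; the factor comes from
giving weight `2` to the interior of a loop. -/
def loopIndex (w : List GaussLetter) (e : GaussLetter) : ℤ :=
  pairing w (fun _ => 1) (loopWeight w e)

/-- Four times the intersection number of the loops of `c` and `d`. -/
def loopInter (w : List GaussLetter) (c d : GaussLetter) : ℤ :=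
  pairing w (loopWeight w c) (loopWeight w d)

/-- Crossings are represented by their upper passages. Those whose loop has intersection number
`-2` with the knot are counted with their signs, all the others with weight `0`. -/
def crossingWeight (w : List GaussLetter) (c : GaussLetter) : ℤ :=
  if c.isOver = true ∧ loopIndex w c = -4 then c.sgn else 0

/-- The signed number of chains `c, c₁, …, cₖ` of crossings of nonzero weight in which the loops of
consecutive crossings have intersection number `-2`; the sign of `c` is not counted. -/
def chainsFrom (w : List GaussLetter) : ℕ → GaussLetter → ℤ
  | 0, _ => 1
  | k + 1, c => (w.map fun d =>
      crossingWeight w d * if loopInter w c d = -8 then chainsFrom w k d else 0).sum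

/-- The signed number of chains of `k + 1` crossings of nonzero weight in which the loops of
consecutive crossings have intersection number `-2`. -/
def chainCount (w : List GaussLetter) (k : ℕ) : ℤ :=
  (w.map fun c => crossingWeight w c * chainsFrom w k c).sum

section Pairing

variable {w w' : List GaussLetter} {φ φ' ψ ψ' : GaussLetter → ℤ}

theorem pairing_perm (h : w.Perm w') (φ ψ : GaussLetter → ℤ) :
    pairing w φ ψ = pairing w' φ ψ := (h.map _).sum_eq

theorem pairing_append (u v : List GaussLetter) (φ ψ : GaussLetter → ℤ) :
    pairing (u ++ v) φ ψ = pairing u φ ψ + pairing v φ ψ := by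
  simp [pairing]

theorem pairing_congr (hw : IsGaussWord w) (h : ∀ x ∈ w, φ x = φ' x) (h' : ∀ x ∈ w, ψ x = ψ' x) :
    pairing w φ ψ = pairing w φ' ψ' := by
  unfold pairing
  congr 1
  exact List.map_congr_left fun x hx => by rw [h x hx, h' _ (hw.mate_mem x hx)]

theorem pairing_add_left (w : List GaussLetter) (φ φ' ψ : GaussLetter → ℤ) :
    pairing w (fun x => φ x + φ' x) ψ = pairing w φ ψ + pairing w φ' ψ := by
  simp only [pairing, ← List.sum_map_add]
  congr 1; exact List.map_congr_left fun x _ => by ring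

theorem pairing_mul_left (w : List GaussLetter) (a : ℤ) (φ ψ : GaussLetter → ℤ) :
    pairing w (fun x => a * φ x) ψ = a * pairing w φ ψ := by
  simp only [pairing, ← List.sum_map_mul_left]
  congr 1; exact List.map_congr_left fun x _ => by ring

theorem IsGaussWord.map_mate_perm (hw : IsGaussWord w) : (w.map GaussLetter.mate).Perm w := by
  refine (List.perm_ext_iff_of_nodup (hw.nodup.map GaussLetter.mate_injective) hw.nodup).2
    fun x => ⟨fun hx => ?_, fun hx => ?_⟩
  · obtain ⟨y, hy, rfl⟩ := List.mem_map.1 hx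
    exact hw.mate_mem y hy
  · exact List.mem_map.2 ⟨x.mate, hw.mate_mem x hx, x.mate_mate⟩

theorem pairing_swap (hw : IsGaussWord w) (φ ψ : GaussLetter → ℤ) :
    pairing w ψ φ = -pairing w φ ψ := by
  rw [pairing, ← (hw.map_mate_perm.map _).sum_eq, List.map_map, pairing, neg_eq_neg_one_mul,
    ← List.sum_map_mul_left]
  congr 1
  exact List.map_congr_left fun x _ => by simp; ring

theorem pairing_add_right (w : List GaussLetter) (φ ψ ψ' : GaussLetter → ℤ) :
    pairing w φ (fun x => ψ x + ψ' x) = pairing w φ ψ + pairing w φ ψ' := by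
  simp only [pairing, ← List.sum_map_add]
  congr 1; exact List.map_congr_left fun x _ => by ring

theorem pairing_const_const (hw : IsGaussWord w) (a b : ℤ) :
    pairing w (fun _ => a) (fun _ => b) = 0 := by
  have h := pairing_swap hw (fun _ => a) (fun _ => b)
  have h2 : pairing w (fun _ => b) (fun _ => a) = pairing w (fun _ => a) (fun _ => b) := by
    unfold pairing
    congr 1
    exact List.map_congr_left fun x _ => by ring
  omega

theorem pairing_single (hw : w.Nodup) {a : GaussLetter} (ha : a ∈ w) (ψ : GaussLetter → ℤ) :
    pairing w (fun x => if x = a then 1 else 0) ψ = a.charge * ψ a.mate := by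
  rw [pairing, ← List.sum_toFinset _ hw, Finset.sum_eq_single a]
  · simp
  · intro b _ hb; simp [hb]
  · intro h; simp [ha] at h

theorem pairing_const_left (w : List GaussLetter) (a : ℤ) (ψ : GaussLetter → ℤ) :
    pairing w (fun _ => a) ψ = a * pairing w (fun _ => 1) ψ := by
  rw [← pairing_mul_left]; simp

end Pairing

section ChainCount

variable {w w' : List GaussLetter}

theorem crossingWeight_eq_zero_or (w : List GaussLetter) (c : GaussLetter) :
    crossingWeight w c = 0 ∨ c.isOver = true ∧ loopIndex w c = -4 := by
  unfold crossingWeight; split_ifs with h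
  · exact Or.inr h
  · exact Or.inl rfl

/-- The chain count only depends on the indices of the loops and on their mutual intersection
numbers. -/
theorem chainCount_congr {g : GaussLetter → GaussLetter} (hp : (w.map g).Perm w')
    (hsgn : ∀ c ∈ w, (g c).sgn = c.sgn) (hover : ∀ c ∈ w, (g c).isOver = c.isOver)
    (hindex : ∀ c ∈ w, c.isOver = true → loopIndex w' (g c) = loopIndex w c)
    (hinter : ∀ c ∈ w, ∀ d ∈ w, c.isOver = true → d.isOver = true →
      loopInter w' (g c) (g d) = loopInter w c d) (k : ℕ) :
    chainCount w' k = chainCount w k := by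
  have hweight : ∀ c ∈ w, crossingWeight w' (g c) = crossingWeight w c := by
    intro c hc
    unfold crossingWeight
    rw [hover c hc, hsgn c hc]
    by_cases h : c.isOver = true
    · rw [hindex c hc h]
    · simp [h]
  have hchains : ∀ k, ∀ c ∈ w, c.isOver = true →
      chainsFrom w' k (g c) = chainsFrom w k c := by
    intro k
    induction k with
    | zero => intro c _ _; rfl
    | succ k ih =>
      intro c hc hco
      simp only [chainsFrom]
      rw [← (hp.map _).sum_eq, List.map_map]
      congr 1
      refine List.map_congr_left fun d hd => ?_
      simp only [Function.comp]
      rw [hweight d hd]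
      rcases crossingWeight_eq_zero_or w d with h | ⟨h, -⟩
      · simp [h]
      · rw [hinter c hc d hd hco h, ih d hd h]
  rw [chainCount, ← (hp.map _).sum_eq, List.map_map]
  congr 1
  refine List.map_congr_left fun c hc => ?_
  simp only [Function.comp]
  rw [hweight c hc]
  rcases crossingWeight_eq_zero_or w c with h | ⟨h, -⟩
  · simp [h]
  · rw [hchains k c hc h]

theorem chainCount_congr_perm (hp : w.Perm w')
    (hindex : ∀ c ∈ w, c.isOver = true → loopIndex w' c = loopIndex w c)
    (hinter : ∀ c ∈ w, ∀ d ∈ w, c.isOver = true → d.isOver = true →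
      loopInter w' c d = loopInter w c d) (k : ℕ) :
    chainCount w' k = chainCount w k :=
  chainCount_congr (g := id) (by simpa using hp) (fun _ _ => rfl) (fun _ _ => rfl) hindex hinter k

/-- Letters may be deleted if the chains through them cancel. -/
theorem chainCount_delete {l : List GaussLetter} (hp : w.Perm (l ++ w'))
    (hindex : ∀ c ∈ w', c.isOver = true → loopIndex w c = loopIndex w' c)
    (hinter : ∀ c ∈ w', ∀ d ∈ w', c.isOver = true → d.isOver = true →
      loopInter w c d = loopInter w' c d)
    (hl : ∀ k, (l.map fun c => crossingWeight w c * chainsFrom w k c).sum = 0)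
    (hl' : ∀ c ∈ w', ∀ k, c.isOver = true → (l.map fun d =>
      crossingWeight w d * if loopInter w c d = -8 then chainsFrom w k d else 0).sum = 0)
    (k : ℕ) : chainCount w k = chainCount w' k := by
  have hweight : ∀ c ∈ w', crossingWeight w c = crossingWeight w' c := by
    intro c hc
    unfold crossingWeight
    by_cases h : c.isOver = true
    · rw [hindex c hc h]
    · simp [h]
  have hchains : ∀ k, ∀ c ∈ w', c.isOver = true →
      chainsFrom w k c = chainsFrom w' k c := by
    intro k
    induction k with
    | zero => intro c _ _; rfl
    | succ k ih =>
      intro c hc hco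
      simp only [chainsFrom]
      rw [(hp.map _).sum_eq, List.map_append, List.sum_append, hl' c hc k hco, zero_add]
      congr 1
      refine List.map_congr_left fun d hd => ?_
      rw [hweight d hd]
      rcases crossingWeight_eq_zero_or w' d with h | ⟨h, -⟩
      · simp [h]
      · rw [hinter c hc d hd hco h, ih d hd h]
  rw [chainCount, (hp.map _).sum_eq, List.map_append, List.sum_append, hl k, zero_add]
  unfold chainCount
  congr 1
  refine List.map_congr_left fun c hc => ?_
  rw [hweight c hc]
  rcases crossingWeight_eq_zero_or w' c with h | ⟨h, -⟩
  · simp [h]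
  · rw [hchains k c hc h]

end ChainCount

/-! ### Base point, renaming, and the first two Reidemeister moves -/

theorem IsGaussWord.of_perm_append {w l w' : List GaussLetter} (hw : IsGaussWord w)
    (hp : w.Perm (l ++ w')) (hl : ∀ x ∈ l, x.mate ∈ l) : IsGaussWord w' where
  nodup := (List.nodup_append.1 (hp.nodup_iff.1 hw.nodup)).2.1
  mate_mem := by
    intro x hx
    have hx' : x.mate ∈ l ++ w' := hp.mem_iff.1 (hw.mate_mem x (hp.mem_iff.2 (by simp [hx])))
    refine (List.mem_append.1 hx').resolve_left fun h => ?_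
    have h2 := hl _ h
    rw [GaussLetter.mate_mate] at h2
    exact (List.nodup_append.1 (hp.nodup_iff.1 hw.nodup)).2.2 x h2 x hx rfl
  eq_or_eq_mate := fun x hx y hy =>
    hw.eq_or_eq_mate x (hp.mem_iff.2 (by simp [hx])) y (hp.mem_iff.2 (by simp [hy]))

section BasePoint

theorem loopWeight_rotate {u v : List GaussLetter} (hw : IsGaussWord (u ++ v))
    {e x : GaussLetter} (he : e ∈ u ++ v) (hx : x ∈ u ++ v) :
    loopWeight (v ++ u) e x = loopWeight (u ++ v) e x := by
  have hdisj := (List.nodup_append.1 hw.nodup).2.2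
  have key : ∀ s ∈ u ++ v, ∀ t ∈ u ++ v, side (v ++ u) s t = side (u ++ v) s t +
      ((if s ∈ u then 2 else 0) - if t ∈ u then 2 else 0) := by
    intro s hs t ht
    by_cases hs' : s ∈ u <;> by_cases ht' : t ∈ u
    · have h1 : s ∉ v := fun h => hdisj s hs' s h rfl
      have h2 : t ∉ v := fun h => hdisj t ht' t h rfl
      simp [side_append_left hs' ht', side_append_right h1 h2, hs', ht']
    · have h1 : s ∉ v := fun h => hdisj s hs' s h rfl
      have h2 : t ∈ v := (List.mem_append.1 ht).resolve_left ht'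
      simp [side_append_lt hs' ht', side_append_gt h1 h2, hs', ht']
    · have h1 : s ∈ v := (List.mem_append.1 hs).resolve_left hs'
      have h2 : t ∉ v := fun h => hdisj t ht' t h rfl
      simp [side_append_gt hs' ht', side_append_lt h1 h2, hs', ht']
    · have h1 : s ∈ v := (List.mem_append.1 hs).resolve_left hs'
      have h2 : t ∈ v := (List.mem_append.1 ht).resolve_left ht'
      simp [side_append_right hs' ht', side_append_left h1 h2, hs', ht']
  have he' := hw.mate_mem e he
  unfold loopWeight
  rw [key x hx e he, key x hx _ he', key e he _ he']
  ring

theorem loopInter_rotate {u v : List GaussLetter} (hw : IsGaussWord (u ++ v))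
    {c d : GaussLetter} (hc : c ∈ u ++ v) (hd : d ∈ u ++ v) :
    loopInter (v ++ u) c d = loopInter (u ++ v) c d := by
  rw [loopInter, pairing_perm List.perm_append_comm]
  exact pairing_congr hw (fun x hx => loopWeight_rotate hw hc hx)
    (fun x hx => loopWeight_rotate hw hd hx)

theorem loopIndex_rotate {u v : List GaussLetter} (hw : IsGaussWord (u ++ v))
    {c : GaussLetter} (hc : c ∈ u ++ v) : loopIndex (v ++ u) c = loopIndex (u ++ v) c := by
  rw [loopIndex, pairing_perm List.perm_append_comm]
  exact pairing_congr hw (fun x hx => rfl) (fun x hx => loopWeight_rotate hw hc hx)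

theorem chainCount_rotate {u v : List GaussLetter} (hw : IsGaussWord (u ++ v)) (k : ℕ) :
    chainCount (v ++ u) k = chainCount (u ++ v) k :=
  chainCount_congr_perm List.perm_append_comm (fun _ hc _ => loopIndex_rotate hw hc)
    (fun _ hc _ hd _ _ => loopInter_rotate hw hc hd) k

end BasePoint

section Rename

variable {f : ℕ → ℕ}

theorem loopWeight_rename (hf : Function.Injective f) (w : List GaussLetter) (e x : GaussLetter) :
    loopWeight (w.map (GaussLetter.rename f)) (e.rename f) (x.rename f) = loopWeight w e x := by
  simp only [loopWeight, GaussLetter.rename_mate, side_map (GaussLetter.rename_injective hf)]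

theorem loopInter_rename (hf : Function.Injective f) (w : List GaussLetter) (c d : GaussLetter) :
    loopInter (w.map (GaussLetter.rename f)) (c.rename f) (d.rename f) = loopInter w c d := by
  simp only [loopInter, pairing, List.map_map, Function.comp_def, GaussLetter.rename_mate,
    loopWeight_rename hf, GaussLetter.rename_charge]

theorem loopIndex_rename (hf : Function.Injective f) (w : List GaussLetter) (c : GaussLetter) :
    loopIndex (w.map (GaussLetter.rename f)) (c.rename f) = loopIndex w c := by
  simp only [loopIndex, pairing, List.map_map, Function.comp_def, GaussLetter.rename_mate,
    loopWeight_rename hf, GaussLetter.rename_charge]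

theorem chainCount_rename (hf : Function.Injective f) (w : List GaussLetter) (k : ℕ) :
    chainCount (w.map (GaussLetter.rename f)) k = chainCount w k :=
  chainCount_congr (g := GaussLetter.rename f) (List.Perm.refl _) (fun _ _ => rfl)
    (fun _ _ => rfl) (fun c _ _ => loopIndex_rename hf w c)
    (fun c _ d _ _ _ => loopInter_rename hf w c d) k

end Rename

section Delete

variable {w w' l : List GaussLetter}

theorem loopWeight_sublist (hw : w.Nodup) (hw' : IsGaussWord w') (hs : w'.Sublist w)
    {e x : GaussLetter} (he : e ∈ w') (hx : x ∈ w') : loopWeight w e x = loopWeight w' e x := by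
  have he' := hw'.mate_mem e he
  simp only [loopWeight, side_sublist hs hw hx he, side_sublist hs hw hx he',
    side_sublist hs hw he he']

theorem loopIndex_delete (hw : w.Nodup) (hw' : IsGaussWord w') (hs : w'.Sublist w)
    (hp : w.Perm (l ++ w')) {c : GaussLetter} (hc : c ∈ w')
    (h : pairing l (fun _ => 1) (loopWeight w c) = 0) : loopIndex w c = loopIndex w' c := by
  rw [loopIndex, pairing_perm hp, pairing_append, h, zero_add]
  exact pairing_congr hw' (fun _ _ => rfl) fun x hx => loopWeight_sublist hw hw' hs hc hx

theorem loopInter_delete (hw : w.Nodup) (hw' : IsGaussWord w') (hs : w'.Sublist w)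
    (hp : w.Perm (l ++ w')) {c d : GaussLetter} (hc : c ∈ w') (hd : d ∈ w')
    (h : pairing l (loopWeight w c) (loopWeight w d) = 0) :
    loopInter w c d = loopInter w' c d := by
  rw [loopInter, pairing_perm hp, pairing_append, h, zero_add]
  exact pairing_congr hw' (fun x hx => loopWeight_sublist hw hw' hs hc hx)
    fun x hx => loopWeight_sublist hw hw' hs hd hx

/-- The loop of a kink has intersection number `0` with the knot, so a kink is not counted. -/
theorem chainCount_r1 {x : GaussLetter} (hw : IsGaussWord ([x, x.mate] ++ w')) (k : ℕ) :
    chainCount ([x, x.mate] ++ w') k = chainCount w' k := by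
  have hw' : IsGaussWord w' := hw.of_perm_append (List.Perm.refl _) (by simp)
  set w := [x, x.mate] ++ w' with hwdef
  have hs : w'.Sublist w := List.sublist_append_right _ _
  have hp : w.Perm ([x, x.mate] ++ w') := List.Perm.refl _
  have hdisj : ∀ z ∈ w', z ∉ [x, x.mate] := fun z hz hz' =>
    (List.nodup_append.1 hw.nodup).2.2 z hz' z hz rfl
  have hlt : ∀ c ∈ [x, x.mate], ∀ z ∉ [x, x.mate], side w c z = 0 :=
    fun c hc z hz => side_append_lt hc hz
  have hconst : ∀ c ∈ w', loopWeight w c x = loopWeight w c x.mate := by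
    intro c hc
    have h1 := hdisj c hc
    have h2 := hdisj _ (hw'.mate_mem c hc)
    have hx : x ∈ [x, x.mate] := by simp
    have hx' : x.mate ∈ [x, x.mate] := by simp
    simp only [loopWeight, hlt x hx c h1, hlt x hx _ h2, hlt _ hx' c h1, hlt _ hx' _ h2]
  have hzero : ∀ c ∈ [x, x.mate], crossingWeight w c = 0 := by
    intro c hc
    have hc' : c.mate ∈ [x, x.mate] := by
      simp only [List.mem_cons, List.not_mem_nil, or_false] at hc ⊢
      rcases hc with rfl | rfl <;> simp
    have hx : ∀ z ∈ w', loopWeight w c z = side w c c.mate := by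
      intro z hz
      simp only [loopWeight]
      rw [side_swap w c z, side_swap w c.mate z, hlt c hc z (hdisj z hz),
        hlt _ hc' z (hdisj z hz)]
      ring
    have hends : loopWeight w c x = loopWeight w c x.mate := by
      have e1 : loopWeight w c c = 1 := by simp [loopWeight]
      have e2 : loopWeight w c c.mate = 1 := by
        simp only [loopWeight, side_self]
        rw [side_swap _ c.mate c]; ring
      simp only [List.mem_cons, List.not_mem_nil, or_false] at hc
      rcases hc with rfl | rfl
      · rw [e1, e2]
      · rw [GaussLetter.mate_mate] at e2
        rw [e1, e2]
    have h0 : loopIndex w c = 0 := by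
      rw [loopIndex, pairing_perm hp, pairing_append, pairing_congr hw' (fun _ _ => rfl) hx,
        pairing_const_const hw']
      simp [pairing, hends]
    simp [crossingWeight, h0]
  have hzx := hzero x (by simp)
  have hzx' := hzero x.mate (by simp)
  refine chainCount_delete hp ?_ ?_ ?_ ?_ k
  · intro c hc _
    refine loopIndex_delete hw.nodup hw' hs hp hc ?_
    simp [pairing, hconst c hc]
  · intro c hc d hd _ _
    refine loopInter_delete hw.nodup hw' hs hp hc hd ?_
    simp [pairing, hconst c hc, hconst d hd]
  · intro k; simp [hzx, hzx']
  · intro c _ k _; simp [hzx, hzx']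

/-- `x` and `y` are neighbours in `w`, in this order if `τ = 1` and in the other order if
`τ = -1`. -/
def Neighbours (w : List GaussLetter) (τ : ℤ) (x y : GaussLetter) : Prop :=
  side w x y = 1 - τ ∧ ∀ z, z ≠ x → z ≠ y → side w x z = side w y z

theorem neighbours_of_nodup {u v : List GaussLetter} {x y : GaussLetter}
    (h : (u ++ [x, y] ++ v).Nodup) : Neighbours (u ++ [x, y] ++ v) 1 x y :=
  ⟨by simpa using side_pair h, fun _ hx hy => side_neighbours h hx hy⟩

theorem Neighbours.symm {τ : ℤ} {x y : GaussLetter} (h : Neighbours w τ x y) :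
    Neighbours w (-τ) y x :=
  ⟨by rw [side_swap, h.1]; ring, fun z hy hx => (h.2 z hx hy).symm⟩

/-- The order in which `orderedPair e x y` lists `x` and `y`, as a sign. -/
def orderSign (e : Bool) : ℤ := if e then 1 else -1

theorem neighbours_orderedPair (e : Bool) (u v : List GaussLetter) (x y : GaussLetter)
    (h : (u ++ orderedPair e x y ++ v).Nodup) :
    Neighbours (u ++ orderedPair e x y ++ v) (orderSign e) x y := by
  cases e
  · exact (neighbours_of_nodup (x := y) (y := x) h).symm
  · exact neighbours_of_nodup h

theorem Neighbours.side_right {τ : ℤ} {x y : GaussLetter} (h : Neighbours w τ x y)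
    {z : GaussLetter} (hx : z ≠ x) (hy : z ≠ y) : side w z x = side w z y := by
  rw [side_swap w x, side_swap w y, h.2 z hx hy]

theorem Neighbours.loopWeight_eq {τ : ℤ} {x y e : GaussLetter} (h : Neighbours w τ x y)
    (hx : e ≠ x) (hy : e ≠ y) (hx' : e.mate ≠ x) (hy' : e.mate ≠ y) :
    loopWeight w e x = loopWeight w e y := by
  simp only [loopWeight, h.2 e hx hy, h.2 e.mate hx' hy']

/-- The two crossings of a second Reidemeister move have homologous loops. -/
theorem pairing_loopWeight_eq (hw : IsGaussWord w) {x y : GaussLetter} {σ τ : ℤ}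
    (hx : x ∈ w) (hy : y ∈ w) (hxy : x ≠ y) (hxy' : x ≠ y.mate)
    (h : Neighbours w σ x y) (h' : Neighbours w τ x.mate y.mate) (hc : y.charge = -x.charge)
    {ψ : GaussLetter → ℤ}
    (hψ : σ * (ψ x.mate - ψ y.mate) + τ * (ψ x - ψ y) = 0) :
    pairing w (loopWeight w x) ψ = pairing w (loopWeight w y) ψ := by
  have hyx' : y ≠ x.mate := fun e => hxy' (by rw [e, GaussLetter.mate_mate])
  have hxx := x.mate_ne
  have hyy := y.mate_ne
  have hmm : x.mate ≠ y.mate := fun e => hxy (GaussLetter.mate_injective e)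
  have hside : ∀ (τ : ℤ) (x y z : GaussLetter), x ≠ y → Neighbours w τ x y →
      side w z x = side w z y +
      τ * ((if z = x then 1 else 0) + if z = y then 1 else 0) := by
    intro τ x y z hxy h
    by_cases hzx : z = x
    · subst hzx; simp [h.1, hxy]
    · by_cases hzy : z = y
      · subst hzy; rw [side_swap]; simp [h.1, hxy.symm]; ring
      · simp [hzx, hzy, h.side_right hzx hzy]
  -- the loops start in the same place and end in the same place
  have hbase : side w x x.mate = side w y y.mate := by
    rw [h.2 _ hxx hyx'.symm, h'.side_right hyx' hyy.symm]
  have hdiff : ∀ z, loopWeight w x z = loopWeight w y z +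
      (σ * ((if z = x then 1 else 0) + if z = y then 1 else 0) +
        -τ * ((if z = x.mate then 1 else 0) + if z = y.mate then 1 else 0)) := by
    intro z
    simp only [loopWeight, hbase, hside σ x y z hxy h, hside τ _ _ z hmm h']
    ring
  have e : pairing w (loopWeight w x) ψ = pairing w (fun z => loopWeight w y z +
      (σ * ((if z = x then 1 else 0) + if z = y then 1 else 0) +
        -τ * ((if z = x.mate then 1 else 0) + if z = y.mate then 1 else 0))) ψ :=
    pairing_congr hw (fun z _ => hdiff z) fun _ _ => rfl
  rw [e, pairing_add_left, pairing_add_left, pairing_mul_left, pairing_mul_left, pairing_add_left,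
    pairing_add_left, pairing_single hw.nodup hx, pairing_single hw.nodup hy,
    pairing_single hw.nodup (hw.mate_mem x hx), pairing_single hw.nodup (hw.mate_mem y hy)]
  simp only [GaussLetter.charge_mate, GaussLetter.mate_mate, hc]
  linear_combination x.charge * hψ

/-- The chains through the two crossings of a second Reidemeister move cancel. -/
theorem chainCount_delete_pair (hw : IsGaussWord w) {x y : GaussLetter} {σ τ : ℤ}
    (hp : w.Perm ([x, y, x.mate, y.mate] ++ w')) (hs : w'.Sublist w)
    (hx : x.isOver = true) (hy : y.isOver = true)
    (h : Neighbours w σ x y) (h' : Neighbours w τ x.mate y.mate)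
    (hsgn : x.isPos ≠ y.isPos) (k : ℕ) :
    chainCount w k = chainCount w' k := by
  have hw' : IsGaussWord w' := hw.of_perm_append hp (by simp)
  have hnd := hp.nodup_iff.1 hw.nodup
  have hdisj : ∀ z ∈ w', z ∉ [x, y, x.mate, y.mate] := fun z hz hz' =>
    (List.nodup_append.1 hnd).2.2 z hz' z hz rfl
  have hxy : x ≠ y := fun e => hsgn (by rw [e])
  have hxy' : x ≠ y.mate := fun e => hsgn (by rw [e]; rfl)
  have hyx' : y ≠ x.mate := fun e => hsgn (by rw [e]; rfl)
  have hs2 : y.sgn = -x.sgn := by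
    unfold GaussLetter.sgn
    cases h1 : x.isPos <;> cases h2 : y.isPos <;> simp_all
  have hc : y.charge = -x.charge := by
    rw [GaussLetter.charge_of_isOver hx, GaussLetter.charge_of_isOver hy, hs2]
  have hxw : x ∈ w := hp.mem_iff.2 (by simp)
  have hyw : y ∈ w := hp.mem_iff.2 (by simp)
  have hfar : ∀ c ∈ w', loopWeight w c x = loopWeight w c y ∧
      loopWeight w c x.mate = loopWeight w c y.mate := by
    intro c hc
    have h1 := hdisj c hc
    have h2 := hdisj _ (hw'.mate_mem c hc)
    simp only [List.mem_cons, List.not_mem_nil, or_false, not_or] at h1 h2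
    exact ⟨h.loopWeight_eq h1.1 h1.2.1 h2.1 h2.2.1,
      h'.loopWeight_eq h1.2.2.1 h1.2.2.2 h2.2.2.1 h2.2.2.2⟩
  have hindex : loopIndex w x = loopIndex w y := by
    rw [loopIndex, loopIndex, pairing_swap hw, pairing_swap hw (loopWeight w y),
      pairing_loopWeight_eq hw hxw hyw hxy hxy' h h' hc (by ring)]
  have hinter : ∀ d ∈ w, d.isOver = true → loopInter w x d = loopInter w y d := by
    intro d hd hdo
    refine pairing_loopWeight_eq hw hxw hyw hxy hxy' h h' hc ?_
    have hd' := hp.mem_iff.1 hd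
    simp only [List.cons_append, List.nil_append, List.mem_cons] at hd'
    have e1 : side w y.mate x.mate = 1 + τ := by rw [side_swap, h'.1]; ring
    have e2 : side w y x = 1 + σ := by rw [side_swap, h.1]; ring
    rcases hd' with rfl | rfl | rfl | rfl | hd'
    · have e3 := h'.2 d (GaussLetter.mate_ne d).symm hxy'
      have e4 := h.2 d.mate (GaussLetter.mate_ne d) hyx'.symm
      simp only [loopWeight, side_self, e1, e2, e3, e4]; ring
    · have e3 := h'.2 d hyx' (GaussLetter.mate_ne d).symm
      have e4 := h.2 d.mate hxy'.symm (GaussLetter.mate_ne d)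
      simp only [loopWeight, side_self, h.1, h'.1, e3, e4]; ring
    · simp [hx] at hdo
    · simp [hy] at hdo
    · rw [(hfar d hd').1, (hfar d hd').2]; ring
  have hwx : crossingWeight w x.mate = 0 := by simp [crossingWeight, hx]
  have hwy : crossingWeight w y.mate = 0 := by simp [crossingWeight, hy]
  have hwxy : crossingWeight w y = -crossingWeight w x := by
    simp only [crossingWeight, hx, hy, hindex, hs2]
    split_ifs <;> simp
  have hchains : ∀ k, chainsFrom w k x = chainsFrom w k y := by
    intro k
    cases k with
    | zero => rfl
    | succ k =>
      simp only [chainsFrom]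
      congr 1
      refine List.map_congr_left fun d hd => ?_
      rcases crossingWeight_eq_zero_or w d with h | ⟨h, -⟩
      · simp [h]
      · rw [hinter d hd h]
  refine chainCount_delete hp ?_ ?_ ?_ ?_ k
  · intro c hcw _
    refine loopIndex_delete hw.nodup hw' hs hp hcw ?_
    simp [pairing, (hfar c hcw).1, (hfar c hcw).2, hc]
  · intro c hcw d hdw _ _
    refine loopInter_delete hw.nodup hw' hs hp hcw hdw ?_
    simp [pairing, (hfar c hcw).1, (hfar c hcw).2, (hfar d hdw).1, (hfar d hdw).2, hc]
  · intro k; simp [hwx, hwy, hwxy, hchains]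
  · intro c hcw k hco
    have : loopInter w c x = loopInter w c y := by
      have hcw' : c ∈ w := hp.mem_iff.2 (by simp [hcw])
      rw [loopInter, pairing_swap hw, ← loopInter, hinter c hcw' hco, loopInter,
        pairing_swap hw, neg_neg, loopInter]
    simp only [List.map_cons, List.map_nil, List.sum_cons, List.sum_nil, hwx, hwy, hwxy, hchains,
      this]
    ring

theorem orderedPair_perm (e : Bool) (x y : GaussLetter) : (orderedPair e x y).Perm [x, y] := by
  cases e
  · exact List.Perm.swap x y []
  · exact List.Perm.refl _

theorem chainCount_r2 {e : Bool} {x y : GaussLetter} {u v : List GaussLetter}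
    (hlevel : x.isOver = y.isOver) (hsign : x.isPos ≠ y.isPos)
    (hw : IsGaussWord ([x, y] ++ u ++ orderedPair e x.mate y.mate ++ v)) (k : ℕ) :
    chainCount ([x, y] ++ u ++ orderedPair e x.mate y.mate ++ v) k = chainCount (u ++ v) k := by
  set w := [x, y] ++ u ++ orderedPair e x.mate y.mate ++ v with hwdef
  have hs : (u ++ v).Sublist w := by
    simp only [hwdef, List.append_assoc]
    exact ((List.Sublist.refl u).append (List.sublist_append_right _ _)).trans
      (List.sublist_append_right _ _)
  have h : Neighbours w 1 x y := by
    have := hw.nodup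
    have e1 : w = [] ++ [x, y] ++ (u ++ orderedPair e x.mate y.mate ++ v) := by
      simp [hwdef, List.append_assoc]
    rw [e1] at this ⊢
    exact neighbours_of_nodup this
  have h' := neighbours_orderedPair e ([x, y] ++ u) v x.mate y.mate hw.nodup
  have hp : w.Perm ([x, y, x.mate, y.mate] ++ (u ++ v)) := by
    have h1 := orderedPair_perm e x.mate y.mate
    rw [List.perm_iff_count]
    intro a
    have := (List.perm_iff_count.1 h1) a
    simp only [hwdef, List.count_append, List.count_cons, List.count_nil] at this ⊢
    omega
  cases hx : x.isOver
  · refine chainCount_delete_pair (x := x.mate) (y := y.mate) hw ?_ hs (by simp [hx])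
      (by simp [← hlevel, hx]) h' (by simpa using h) hsign k
    refine hp.trans ?_
    rw [List.perm_iff_count]
    intro a
    simp only [List.count_append, List.count_cons, List.count_nil, GaussLetter.mate_mate]
    omega
  · exact chainCount_delete_pair hw hp hs hx (hlevel ▸ hx) h h' hsign k

end Delete

/-! ### The third Reidemeister move -/

section Triangle

variable {w w' : List GaussLetter}

theorem Neighbours.loopWeight_sub {τ : ℤ} {x y : GaussLetter} (h : Neighbours w τ x y)
    (hxy : x ≠ y) (f : GaussLetter) :
    loopWeight w f x - loopWeight w f y =
      -τ * ((if f = x then 1 else 0) + (if f = y then 1 else 0) -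
        (if f.mate = x then 1 else 0) - if f.mate = y then 1 else 0) := by
  have hside : ∀ t, side w x t - side w y t =
      -τ * ((if t = x then 1 else 0) + if t = y then 1 else 0) := by
    intro t
    by_cases htx : t = x
    · subst htx
      rw [side_swap w t y, h.1]; simp [hxy]; ring
    · by_cases hty : t = y
      · subst hty; simp [h.1, hxy.symm]
      · simp [htx, hty, h.2 t htx hty]
  simp only [loopWeight]
  linear_combination hside f - hside f.mate

theorem GaussLetter.ne_mate_of_isOver {x y : GaussLetter} (hx : x.isOver = true)
    (hy : y.isOver = true) : x ≠ y.mate := by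
  intro h
  have := congrArg GaussLetter.isOver h
  simp [hx, hy] at this

/-- The change of the weight of the loop of the upper passage `e` under a third Reidemeister move
of the crossings `a`, `b`, `c`. -/
def triangleDefect (a b c : GaussLetter) (τT τM τB : ℤ) (e z : GaussLetter) : ℤ :=
  (if e = a then 1 else 0) * (-2 * τT * (if z = b then 1 else 0) +
      2 * τM * (if z = c then 1 else 0)) +
    (if e = b then 1 else 0) * (2 * τT * (if z = a then 1 else 0) +
      2 * τB * (if z = c.mate then 1 else 0)) +
    (if e = c then 1 else 0) * (2 * τM * (if z = a.mate then 1 else 0) +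
      -2 * τB * (if z = b.mate then 1 else 0))

variable {a b c : GaussLetter} {τT τM τB : ℤ}

theorem loopWeight_triangle (ha : a.isOver = true) (hb : b.isOver = true) (hc : c.isOver = true)
    (hac : a ≠ c)
    (hside : ∀ s t, side w' s t = side w s t + τT * exchangeSide a b s t +
      τM * exchangeSide a.mate c s t + τB * exchangeSide b.mate c.mate s t)
    {e : GaussLetter} (he : e.isOver = true) (z : GaussLetter) :
    loopWeight w' e z = loopWeight w e z + triangleDefect a b c τT τM τB e z := by
  have heA := GaussLetter.ne_mate_of_isOver he ha
  have heB := GaussLetter.ne_mate_of_isOver he hb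
  have heC := GaussLetter.ne_mate_of_isOver he hc
  have hea := (GaussLetter.ne_mate_of_isOver ha he).symm
  have heb := (GaussLetter.ne_mate_of_isOver hb he).symm
  have hec := (GaussLetter.ne_mate_of_isOver hc he).symm
  have hprod : (if e = c then (1 : ℤ) else 0) * (if e = a then 1 else 0) = 0 := by
    by_cases h : e = a
    · simp [h, hac]
    · simp [h]
  simp only [loopWeight, hside, exchangeSide, triangleDefect, GaussLetter.mate_inj, heA, heB, heC,
    hea, heb, hec, if_false]
  linear_combination (-2 * τM) * hprod

/-- Invariance under the third Reidemeister move. The change of the loop weights pairs trivially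
with every function that takes equal values on neighbours, and its pairing with the loops of the
triangle itself is skew-symmetric. -/
theorem chainCount_triangle (hw : IsGaussWord w) (hp : w.Perm w')
    (ha : a.isOver = true) (hb : b.isOver = true) (hc : c.isOver = true)
    (haw : a ∈ w) (hbw : b ∈ w) (hcw : c ∈ w)
    (hab : a ≠ b) (hac : a ≠ c) (hbc : b ≠ c)
    (hτB : τB * τB = 1)
    (hT : Neighbours w τT a b) (hM : Neighbours w τM a.mate c)
    (hB : Neighbours w τB b.mate c.mate)
    (hside : ∀ s t, side w' s t = side w s t + τT * exchangeSide a b s t +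
      τM * exchangeSide a.mate c s t + τB * exchangeSide b.mate c.mate s t)
    (h₁ : τB * b.sgn = τM * a.sgn) (h₂ : τB * c.sgn = τT * a.sgn) (k : ℕ) :
    chainCount w' k = chainCount w k := by
  have hsb : b.sgn = τB * τM * a.sgn := by linear_combination τB * h₁ - b.sgn * hτB
  have hsc : c.sgn = τB * τT * a.sgn := by linear_combination τB * h₂ - c.sgn * hτB
  have hdefect : ∀ e ψ, pairing w (triangleDefect a b c τT τM τB e) ψ =
      (if e = a then 1 else 0) * (-2 * a.sgn * τT * τM * τB * (ψ b.mate - ψ c.mate)) +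
      (if e = b then 1 else 0) * (2 * a.sgn * τT * (ψ a.mate - ψ c)) +
      (if e = c then 1 else 0) * (-2 * a.sgn * τM * (ψ a - ψ b)) := by
    intro e ψ
    unfold triangleDefect
    simp only [pairing_add_left, pairing_mul_left]
    rw [pairing_single hw.nodup haw, pairing_single hw.nodup hbw, pairing_single hw.nodup hcw,
      pairing_single hw.nodup (hw.mate_mem a haw), pairing_single hw.nodup (hw.mate_mem b hbw),
      pairing_single hw.nodup (hw.mate_mem c hcw)]
    simp only [GaussLetter.charge_mate, GaussLetter.mate_mate, GaussLetter.charge_of_isOver ha,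
      GaussLetter.charge_of_isOver hb, GaussLetter.charge_of_isOver hc]
    rw [hsb, hsc]
    linear_combination ((if e = b then 1 else 0) * (-2 * τT * a.sgn * ψ c) * hτB +
      (if e = c then 1 else 0) * (2 * τM * a.sgn * ψ b) * hτB)
  have hloop : ∀ f, f.isOver = true →
      loopWeight w f b.mate - loopWeight w f c.mate =
        τB * ((if f = b then 1 else 0) + if f = c then 1 else 0) ∧
      loopWeight w f a.mate - loopWeight w f c =
        τM * ((if f = a then 1 else 0) - if f = c then 1 else 0) ∧
      loopWeight w f a - loopWeight w f b =
        -τT * ((if f = a then 1 else 0) + if f = b then 1 else 0) := by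
    intro f hf
    have hfm : ∀ g : GaussLetter, g.isOver = true → f ≠ g.mate ∧ f.mate ≠ g := fun g hg =>
      ⟨GaussLetter.ne_mate_of_isOver hf hg, (GaussLetter.ne_mate_of_isOver hg hf).symm⟩
    refine ⟨?_, ?_, ?_⟩
    · rw [hB.loopWeight_sub (fun e => hbc (GaussLetter.mate_injective e)) f]
      simp only [GaussLetter.mate_inj, (hfm b hb).1, (hfm c hc).1, if_false]
      ring
    · rw [hM.loopWeight_sub (GaussLetter.ne_mate_of_isOver hc ha).symm f]
      simp only [GaussLetter.mate_inj, (hfm a ha).1, (hfm c hc).2, if_false]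
      ring
    · rw [hT.loopWeight_sub hab f]
      simp only [(hfm a ha).2, (hfm b hb).2, if_false]
      ring
  have hdefect_sub : ∀ f,
      triangleDefect a b c τT τM τB f b.mate - triangleDefect a b c τT τM τB f c.mate =
        -2 * (τB * ((if f = b then 1 else 0) + if f = c then 1 else 0)) ∧
      triangleDefect a b c τT τM τB f a.mate - triangleDefect a b c τT τM τB f c =
        -2 * (τM * ((if f = a then 1 else 0) - if f = c then 1 else 0)) ∧
      triangleDefect a b c τT τM τB f a - triangleDefect a b c τT τM τB f b =
        -2 * (-τT * ((if f = a then 1 else 0) + if f = b then 1 else 0)) := by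
    intro f
    have haA := GaussLetter.ne_mate_of_isOver ha ha
    have haB := GaussLetter.ne_mate_of_isOver ha hb
    have haC := GaussLetter.ne_mate_of_isOver ha hc
    have hbA := GaussLetter.ne_mate_of_isOver hb ha
    have hbB := GaussLetter.ne_mate_of_isOver hb hb
    have hbC := GaussLetter.ne_mate_of_isOver hb hc
    have hcA := GaussLetter.ne_mate_of_isOver hc ha
    have hcB := GaussLetter.ne_mate_of_isOver hc hb
    have hcC := GaussLetter.ne_mate_of_isOver hc hc
    refine ⟨?_, ?_, ?_⟩ <;> unfold triangleDefect <;>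
      simp only [GaussLetter.mate_inj, haA, haB, haC, hbA, hbB, hbC, hcA, hcB, hcC, hab, hac, hbc,
        haA.symm, haB.symm, haC.symm, hbA.symm, hbB.symm, hbC.symm, hcA.symm, hcB.symm, hcC.symm,
        hab.symm, hac.symm, hbc.symm, if_true, if_false] <;>
      ring
  have hweight := fun (e : GaussLetter) (he : e.isOver = true) (z : GaussLetter) =>
    loopWeight_triangle ha hb hc hac hside he z
  refine chainCount_congr_perm hp (fun e _ he => ?_) (fun e _ f _ he hf => ?_) k
  · rw [loopIndex, loopIndex, ← pairing_perm hp, pairing_congr hw (fun _ _ => rfl)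
      fun z _ => hweight e he z, pairing_add_right, pairing_swap hw (triangleDefect _ _ _ _ _ _ _),
      hdefect]
    ring
  · rw [loopInter, loopInter, ← pairing_perm hp, pairing_congr hw (fun z _ => hweight e he z)
      fun z _ => hweight f hf z, pairing_add_right, pairing_add_left, pairing_add_left,
      pairing_swap hw (triangleDefect _ _ _ _ _ _ f) (loopWeight w e), hdefect, hdefect, hdefect,
      (hloop f hf).1, (hloop f hf).2.1, (hloop f hf).2.2, (hloop e he).1, (hloop e he).2.1,
      (hloop e he).2.2, (hdefect_sub f).1, (hdefect_sub f).2.1, (hdefect_sub f).2.2]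
    linear_combination (2 * a.sgn * τT * τM) * (
      (if e = a then 1 else 0) * ((if f = b then 1 else 0) + if f = c then 1 else 0) +
      (if f = a then 1 else 0) * ((if e = b then 1 else 0) + if e = c then 1 else 0)) * hτB

end Triangle

theorem side_orderedPair_not (e : Bool) {u v : List GaussLetter} {x y : GaussLetter}
    (h : (u ++ orderedPair e x y ++ v).Nodup) (s t : GaussLetter) :
    side (u ++ orderedPair (!e) x y ++ v) s t = side (u ++ orderedPair e x y ++ v) s t +
      orderSign e * exchangeSide x y s t := by
  cases e
  · refine (side_exchange (x := y) (y := x) h s t).trans ?_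
    simp only [orderedPair, orderSign, exchangeSide]
    simp
    ring
  · refine (side_exchange h s t).trans ?_
    simp [orderedPair, orderSign]

theorem orderedPair_not_perm (e : Bool) (x y : GaussLetter) :
    (orderedPair (!e) x y).Perm (orderedPair e x y) :=
  (orderedPair_perm _ x y).trans (orderedPair_perm e x y).symm

theorem orderSign_mul_sgn {e e' : Bool} {x y : GaussLetter}
    (h : (e = x.isPos) ↔ (e' = y.isPos)) : orderSign e * x.sgn = orderSign e' * y.sgn := by
  unfold orderSign GaussLetter.sgn
  cases e <;> cases e' <;> cases hx : x.isPos <;> cases hy : y.isPos <;> simp_all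

/-- The third Reidemeister move, with the three strands in an arbitrary position in the word. -/
theorem chainCount_r3_aux {a b c : GaussLetter} {eT eM eB : Bool} {w w' : List GaussLetter}
    (ha : a.isOver = true) (hb : b.isOver = true) (hc : c.isOver = true)
    (h₁ : (eB = b.isPos) ↔ (eM = a.isPos)) (h₂ : (eB = c.isPos) ↔ (eT = a.isPos))
    (hw : IsGaussWord w) (hp : w.Perm w') (hac : a ≠ c)
    {u₁ u₂ u₃ v₁ v₂ v₃ : List GaussLetter}
    (hT : w = u₁ ++ orderedPair eT a b ++ v₁)
    (hM : w = u₂ ++ orderedPair eM a.mate c ++ v₂)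
    (hB : w = u₃ ++ orderedPair eB b.mate c.mate ++ v₃)
    (hside : ∀ s t, side w' s t = side w s t + orderSign eT * exchangeSide a b s t +
      orderSign eM * exchangeSide a.mate c s t + orderSign eB * exchangeSide b.mate c.mate s t)
    (k : ℕ) : chainCount w k = chainCount w' k := by
  have hmem : ∀ (e : Bool) (x y : GaussLetter) (u v : List GaussLetter),
      w = u ++ orderedPair e x y ++ v → x ∈ w ∧ y ∈ w ∧ x ≠ y := by
    intro e x y u v h
    have hxy := (orderedPair_perm e x y).nodup_iff.1
      (List.nodup_append.1 (List.nodup_append.1 (h ▸ hw.nodup)).1).2.1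
    refine ⟨?_, ?_, by simpa using hxy⟩ <;> rw [h] <;> cases e <;> simp [orderedPair]
  have hT' := hmem _ _ _ _ _ hT
  have hM' := hmem _ _ _ _ _ hM
  have hB' := hmem _ _ _ _ _ hB
  have hnd := hw.nodup
  refine (chainCount_triangle hw hp ha hb hc hT'.1 hT'.2.1 hM'.2.1 hT'.2.2 hac
    (fun e => hB'.2.2 (by rw [e])) (τT := orderSign eT) (τM := orderSign eM) (τB := orderSign eB)
    ?_ ?_ ?_ ?_ hside (orderSign_mul_sgn h₁) (orderSign_mul_sgn h₂) k).symm
  · cases eB <;> rfl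
  · have := neighbours_orderedPair eT u₁ v₁ a b (hT ▸ hnd); rwa [← hT] at this
  · have := neighbours_orderedPair eM u₂ v₂ a.mate c (hM ▸ hnd); rwa [← hM] at this
  · have := neighbours_orderedPair eB u₃ v₃ b.mate c.mate (hB ▸ hnd); rwa [← hB] at this

theorem chainCount_r3 {a b c : GaussLetter} {eT eM eB : Bool} {u v w : List GaussLetter}
    (ha : a.isOver = true) (hb : b.isOver = true) (hc : c.isOver = true)
    (h₁ : (eB = b.isPos) ↔ (eM = a.isPos)) (h₂ : (eB = c.isPos) ↔ (eT = a.isPos))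
    (hw : IsGaussWord (orderedPair eT a b ++ u ++ orderedPair eM a.mate c ++ v ++
          orderedPair eB b.mate c.mate ++ w)) (k : ℕ) :
    chainCount (orderedPair eT a b ++ u ++ orderedPair eM a.mate c ++ v ++
          orderedPair eB b.mate c.mate ++ w) k =
    chainCount (orderedPair (!eT) a b ++ u ++ orderedPair (!eM) a.mate c ++ v ++
          orderedPair (!eB) b.mate c.mate ++ w) k := by
  have hpT := orderedPair_not_perm eT a b
  have hpM := orderedPair_not_perm eM a.mate c
  have hpB := orderedPair_not_perm eB b.mate c.mate
  have hp := (((((hpT.append_right u).append hpM).append_right v).append hpB).append_right w).symm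
  have n1 : ((orderedPair (!eT) a b ++ u) ++ orderedPair eM a.mate c ++
      (v ++ orderedPair eB b.mate c.mate ++ w)).Nodup := by
    have := ((((hpT.append_right u).append_right (orderedPair eM a.mate c)).append_right
      v).append_right (orderedPair eB b.mate c.mate)).append_right w
    simpa using this.symm.nodup hw.nodup
  have n2 : ((orderedPair (!eT) a b ++ u ++ orderedPair (!eM) a.mate c ++ v) ++
      orderedPair eB b.mate c.mate ++ w).Nodup := by
    have := (((((hpT.append_right u).append hpM)).append_right v).append_right
      (orderedPair eB b.mate c.mate)).append_right w
    simpa using this.symm.nodup hw.nodup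
  have hac : a ≠ c := by
    have := hw.nodup
    simp only [List.append_assoc] at this
    exact (List.nodup_append.1 this).2.2 a (by cases eT <;> simp [orderedPair]) c
      (by cases eM <;> simp [orderedPair])
  refine chainCount_r3_aux ha hb hc h₁ h₂ hw hp hac (u₁ := []) (u₂ := orderedPair eT a b ++ u)
    (u₃ := orderedPair eT a b ++ u ++ orderedPair eM a.mate c ++ v)
    (v₁ := u ++ orderedPair eM a.mate c ++ v ++ orderedPair eB b.mate c.mate ++ w)
    (v₂ := v ++ orderedPair eB b.mate c.mate ++ w) (v₃ := w) (by simp) (by simp) (by simp) ?_ k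
  intro s t
  have e3 := side_orderedPair_not eB n2 s t
  have e2 := side_orderedPair_not eM n1 s t
  have e1 := side_orderedPair_not eT (u := []) (v := u ++ orderedPair eM a.mate c ++ v ++
    orderedPair eB b.mate c.mate ++ w) (x := a) (y := b) (by simpa using hw.nodup) s t
  simp only [List.append_assoc, List.nil_append] at e1 e2 e3 ⊢
  rw [e3, e2, e1]

theorem chainCount_r3' {a b c : GaussLetter} {eT eM eB : Bool} {u v w : List GaussLetter}
    (ha : a.isOver = true) (hb : b.isOver = true) (hc : c.isOver = true)
    (h₁ : (eB = b.isPos) ↔ (eM = a.isPos)) (h₂ : (eB = c.isPos) ↔ (eT = a.isPos))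
    (hw : IsGaussWord (orderedPair eT a b ++ u ++ orderedPair eB b.mate c.mate ++ v ++
          orderedPair eM a.mate c ++ w)) (k : ℕ) :
    chainCount (orderedPair eT a b ++ u ++ orderedPair eB b.mate c.mate ++ v ++
          orderedPair eM a.mate c ++ w) k =
    chainCount (orderedPair (!eT) a b ++ u ++ orderedPair (!eB) b.mate c.mate ++ v ++
          orderedPair (!eM) a.mate c ++ w) k := by
  have hpT := orderedPair_not_perm eT a b
  have hpM := orderedPair_not_perm eM a.mate c
  have hpB := orderedPair_not_perm eB b.mate c.mate
  have hp := (((((hpT.append_right u).append hpB).append_right v).append hpM).append_right w).symm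
  have n1 : ((orderedPair (!eT) a b ++ u) ++ orderedPair eB b.mate c.mate ++
      (v ++ orderedPair eM a.mate c ++ w)).Nodup := by
    have := ((((hpT.append_right u).append_right (orderedPair eB b.mate c.mate)).append_right
      v).append_right (orderedPair eM a.mate c)).append_right w
    simpa using this.symm.nodup hw.nodup
  have n2 : ((orderedPair (!eT) a b ++ u ++ orderedPair (!eB) b.mate c.mate ++ v) ++
      orderedPair eM a.mate c ++ w).Nodup := by
    have := (((((hpT.append_right u).append hpB)).append_right v).append_right
      (orderedPair eM a.mate c)).append_right w
    simpa using this.symm.nodup hw.nodup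
  have hac : a ≠ c := by
    have := hw.nodup
    simp only [List.append_assoc] at this
    exact (List.nodup_append.1 this).2.2 a (by cases eT <;> simp [orderedPair]) c
      (by cases eM <;> simp [orderedPair])
  refine chainCount_r3_aux ha hb hc h₁ h₂ hw hp hac (u₁ := [])
    (u₂ := orderedPair eT a b ++ u ++ orderedPair eB b.mate c.mate ++ v)
    (u₃ := orderedPair eT a b ++ u)
    (v₁ := u ++ orderedPair eB b.mate c.mate ++ v ++ orderedPair eM a.mate c ++ w)
    (v₂ := w) (v₃ := v ++ orderedPair eM a.mate c ++ w) (by simp) (by simp) (by simp) ?_ k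
  intro s t
  have e3 := side_orderedPair_not eM n2 s t
  have e2 := side_orderedPair_not eB n1 s t
  have e1 := side_orderedPair_not eT (u := []) (v := u ++ orderedPair eB b.mate c.mate ++ v ++
    orderedPair eM a.mate c ++ w) (x := a) (y := b) (by simpa using hw.nodup) s t
  simp only [List.append_assoc, List.nil_append] at e1 e2 e3 ⊢
  rw [e3, e2, e1]
  ring

theorem chainCount_step {w w' : List GaussLetter} (h : ReidemeisterStep w w')
    (hw : IsGaussWord w) (k : ℕ) : chainCount w k = chainCount w' k := by
  cases h with
  | rotate u v => exact (chainCount_rotate hw k).symm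
  | rename f hf w => exact (chainCount_rename hf w k).symm
  | r1 x w => exact chainCount_r1 hw k
  | r2 e x y u v hlevel hsign => exact chainCount_r2 hlevel hsign hw k
  | r3 a b c eT eM eB u v w ha hb hc h₁ h₂ => exact chainCount_r3 ha hb hc h₁ h₂ hw k
  | r3' a b c eT eM eB u v w ha hb hc h₁ h₂ => exact chainCount_r3' ha hb hc h₁ h₂ hw k

/-- The chain counts are invariants of virtual knots. -/
theorem chainCount_eq_of_knot_eq {D D' : GaussDiagram} (h : D.knot = D'.knot) (k : ℕ) :
    chainCount D.word k = chainCount D'.word k := by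
  have h' : Relation.EqvGen (fun D D' : GaussDiagram => ReidemeisterStep D.word D'.word) D D' :=
    Quotient.exact h
  clear h
  induction h' with
  | rel D D' h => exact chainCount_step h D.isGaussWord k
  | refl D => rfl
  | symm D D' _ ih => exact ih.symm
  | trans D D' D'' _ _ ih₁ ih₂ => exact ih₁.trans ih₂

/-! ### Chain counts of concatenations -/

/-- The loops counted in the chains of `v` do not pass through the base point. -/
def AvoidsBasePoint (v : List GaussLetter) : Prop :=
  ∀ d ∈ v, crossingWeight v d ≠ 0 → side v d d.mate = 0

section Concatenation

variable {u v : List GaussLetter}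

theorem notMem_of_crossing_ne (huv : ∀ x ∈ u, ∀ y ∈ v, x.crossing ≠ y.crossing) {x : GaussLetter}
    (hx : x ∈ v) : x ∉ u := fun h => huv x h x hx rfl

theorem loopWeight_append_left (hu : IsGaussWord u) {e x : GaussLetter} (he : e ∈ u) (hx : x ∈ u) :
    loopWeight (u ++ v) e x = loopWeight u e x := by
  have he' := hu.mate_mem e he
  simp only [loopWeight, side_append_left hx he, side_append_left hx he', side_append_left he he']

theorem loopWeight_append_right (hv : IsGaussWord v)
    (huv : ∀ x ∈ u, ∀ y ∈ v, x.crossing ≠ y.crossing) {e x : GaussLetter} (he : e ∈ v)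
    (hx : x ∈ v) : loopWeight (u ++ v) e x = loopWeight v e x := by
  have he' := hv.mate_mem e he
  simp only [loopWeight, side_append_right (notMem_of_crossing_ne huv hx)
    (notMem_of_crossing_ne huv he), side_append_right (notMem_of_crossing_ne huv hx)
    (notMem_of_crossing_ne huv he'), side_append_right (notMem_of_crossing_ne huv he)
    (notMem_of_crossing_ne huv he')]

/-- A loop of `u` contains the whole of `v` or nothing of it. -/
theorem loopWeight_append_left_right (hu : IsGaussWord u)
    (huv : ∀ x ∈ u, ∀ y ∈ v, x.crossing ≠ y.crossing) {e x : GaussLetter} (he : e ∈ u)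
    (hx : x ∈ v) : loopWeight (u ++ v) e x = side u e e.mate := by
  have he' := hu.mate_mem e he
  have hxu := notMem_of_crossing_ne huv hx
  simp only [loopWeight, side_append_gt hxu he, side_append_gt hxu he', side_append_left he he']
  ring

theorem loopWeight_append_right_left (hv : IsGaussWord v)
    (huv : ∀ x ∈ u, ∀ y ∈ v, x.crossing ≠ y.crossing) {e x : GaussLetter} (he : e ∈ v)
    (hx : x ∈ u) : loopWeight (u ++ v) e x = side v e e.mate := by
  have he' := hv.mate_mem e he
  have h1 := notMem_of_crossing_ne huv he
  have h2 := notMem_of_crossing_ne huv he'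
  simp only [loopWeight, side_append_lt hx h1, side_append_lt hx h2, side_append_right h1 h2]
  ring

variable (hu : IsGaussWord u) (hv : IsGaussWord v)
  (huv : ∀ x ∈ u, ∀ y ∈ v, x.crossing ≠ y.crossing)

include hu hv huv

theorem loopIndex_append_left {c : GaussLetter} (hc : c ∈ u) :
    loopIndex (u ++ v) c = loopIndex u c := by
  rw [loopIndex, pairing_append,
    pairing_congr hu (fun _ _ => rfl) fun x hx => loopWeight_append_left hu hc hx,
    pairing_congr hv (fun _ _ => rfl) fun x hx => loopWeight_append_left_right hu huv hc hx,
    pairing_const_const hv, add_zero, loopIndex]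

theorem loopIndex_append_right {c : GaussLetter} (hc : c ∈ v) :
    loopIndex (u ++ v) c = loopIndex v c := by
  rw [loopIndex, pairing_append,
    pairing_congr hu (fun _ _ => rfl) fun x hx => loopWeight_append_right_left hv huv hc hx,
    pairing_congr hv (fun _ _ => rfl) fun x hx => loopWeight_append_right hv huv hc hx,
    pairing_const_const hu, zero_add, loopIndex]

theorem loopInter_append_left {c d : GaussLetter} (hc : c ∈ u) (hd : d ∈ u) :
    loopInter (u ++ v) c d = loopInter u c d := by
  rw [loopInter, pairing_append,
    pairing_congr hu (fun x hx => loopWeight_append_left hu hc hx)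
      fun x hx => loopWeight_append_left hu hd hx,
    pairing_congr hv (fun x hx => loopWeight_append_left_right hu huv hc hx)
      fun x hx => loopWeight_append_left_right hu huv hd hx,
    pairing_const_const hv, add_zero, loopInter]

theorem loopInter_append_right {c d : GaussLetter} (hc : c ∈ v) (hd : d ∈ v) :
    loopInter (u ++ v) c d = loopInter v c d := by
  rw [loopInter, pairing_append,
    pairing_congr hu (fun x hx => loopWeight_append_right_left hv huv hc hx)
      fun x hx => loopWeight_append_right_left hv huv hd hx,
    pairing_congr hv (fun x hx => loopWeight_append_right hv huv hc hx)
      fun x hx => loopWeight_append_right hv huv hd hx,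
    pairing_const_const hu, zero_add, loopInter]

theorem loopInter_append_left_right {c d : GaussLetter} (hc : c ∈ u) (hd : d ∈ v) :
    loopInter (u ++ v) c d =
      side u c c.mate * loopIndex v d - side v d d.mate * loopIndex u c := by
  rw [loopInter, pairing_append,
    pairing_congr hu (fun x hx => loopWeight_append_left hu hc hx)
      fun x hx => loopWeight_append_right_left hv huv hd hx,
    pairing_congr hv (fun x hx => loopWeight_append_left_right hu huv hc hx)
      fun x hx => loopWeight_append_right hv huv hd hx,
    pairing_const_left, pairing_swap hu (fun _ => side v d d.mate), pairing_const_left, loopIndex,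
    loopIndex]
  ring

theorem crossingWeight_append_left {c : GaussLetter} (hc : c ∈ u) :
    crossingWeight (u ++ v) c = crossingWeight u c := by
  simp only [crossingWeight, loopIndex_append_left hu hv huv hc]

theorem crossingWeight_append_right {c : GaussLetter} (hc : c ∈ v) :
    crossingWeight (u ++ v) c = crossingWeight v c := by
  simp only [crossingWeight, loopIndex_append_right hu hv huv hc]

/-- A chain of a concatenation `u ++ v` that has entered `v` stays there. -/
theorem chainsFrom_append_right (hb : AvoidsBasePoint v) (k : ℕ) {d : GaussLetter} (hd : d ∈ v)
    (hd0 : crossingWeight v d ≠ 0) : chainsFrom (u ++ v) k d = chainsFrom v k d := by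
  induction k generalizing d with
  | zero => rfl
  | succ k ih =>
    simp only [chainsFrom, List.map_append, List.sum_append]
    have h1 : (u.map fun c => crossingWeight (u ++ v) c *
        if loopInter (u ++ v) d c = -8 then chainsFrom (u ++ v) k c else 0).sum = 0 := by
      refine List.sum_eq_zero fun y hy => ?_
      obtain ⟨c, hc, rfl⟩ := List.mem_map.1 hy
      have hindex : loopIndex v d = -4 :=
        ((crossingWeight_eq_zero_or v d).resolve_left hd0).2
      have hside : 0 ≤ side u c c.mate := by unfold side; split_ifs <;> norm_num
      have hinter : loopInter (u ++ v) d c ≠ -8 := by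
        have h := loopInter_append_left_right hu hv huv hc hd
        rw [loopInter, pairing_swap (hu.append hv huv), ← loopInter, h, hb d hd hd0, hindex]
        omega
      rw [if_neg hinter, mul_zero]
    rw [h1, zero_add]
    congr 1
    refine List.map_congr_left fun c hc => ?_
    rw [crossingWeight_append_right hu hv huv hc, loopInter_append_right hu hv huv hd hc]
    by_cases hc0 : crossingWeight v c = 0
    · simp [hc0]
    · rw [ih hc hc0]

/-- The chains of a concatenation `u ++ v` that start in `u` either stay there or enter `v` from a
loop that contains the whole of `v`; from there on any chain of `v` is possible. -/
theorem chainsFrom_append_left (hb : AvoidsBasePoint v) (k : ℕ) {c : GaussLetter} (hc : c ∈ u) :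
    chainsFrom (u ++ v) (k + 1) c = (u.map fun d => crossingWeight u d *
      if loopInter u c d = -8 then chainsFrom (u ++ v) k d else 0).sum +
      if side u c c.mate = 2 then chainCount v k else 0 := by
  simp only [chainsFrom, List.map_append, List.sum_append]
  congr 1
  · congr 1
    refine List.map_congr_left fun d hd => ?_
    rw [crossingWeight_append_left hu hv huv hd, loopInter_append_left hu hv huv hc hd]
  · have h : ∀ d ∈ v, (crossingWeight (u ++ v) d *
        if loopInter (u ++ v) c d = -8 then chainsFrom (u ++ v) k d else 0) =
        (if side u c c.mate = 2 then 1 else 0) * (crossingWeight v d * chainsFrom v k d) := by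
      intro d hd
      rw [crossingWeight_append_right hu hv huv hd]
      by_cases hd0 : crossingWeight v d = 0
      · simp [hd0]
      · have hindex : loopIndex v d = -4 :=
          ((crossingWeight_eq_zero_or v d).resolve_left hd0).2
        rw [chainsFrom_append_right hu hv huv hb k hd hd0,
          loopInter_append_left_right hu hv huv hc hd, hb d hd hd0, hindex]
        by_cases hs : side u c c.mate = 2
        · simp [hs]
        · rw [if_neg (by omega), if_neg hs]; ring
    rw [List.map_congr_left h, List.sum_map_mul_left, ← chainCount]
    split_ifs <;> simp

theorem chainCount_append (hb : AvoidsBasePoint v) (k : ℕ) :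
    chainCount (u ++ v) k =
      (u.map fun c => crossingWeight u c * chainsFrom (u ++ v) k c).sum + chainCount v k := by
  simp only [chainCount, List.map_append, List.sum_append]
  congr 1
  · congr 1
    exact List.map_congr_left fun c hc => by rw [crossingWeight_append_left hu hv huv hc]
  · congr 1
    refine List.map_congr_left fun d hd => ?_
    rw [crossingWeight_append_right hu hv huv hd]
    by_cases hd0 : crossingWeight v d = 0
    · simp [hd0]
    · rw [chainsFrom_append_right hu hv huv hb k hd hd0]

end Concatenation

/-- The first chain count that distinguishes `v` from `v'` also distinguishes `u ++ v` from
`u ++ v'`. -/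
theorem chainCount_append_sub {u v v' : List GaussLetter} (hu : IsGaussWord u)
    (hv : IsGaussWord v) (hv' : IsGaussWord v')
    (huv : ∀ x ∈ u, ∀ y ∈ v, x.crossing ≠ y.crossing)
    (huv' : ∀ x ∈ u, ∀ y ∈ v', x.crossing ≠ y.crossing)
    (hb : AvoidsBasePoint v) (hb' : AvoidsBasePoint v') {k : ℕ}
    (h : ∀ j < k, chainCount v j = chainCount v' j) :
    chainCount (u ++ v) k - chainCount (u ++ v') k = chainCount v k - chainCount v' k := by
  have hchains : ∀ j ≤ k, ∀ c ∈ u, chainsFrom (u ++ v) j c = chainsFrom (u ++ v') j c := by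
    intro j
    induction j with
    | zero => intro _ _ _; rfl
    | succ j ih =>
      intro hj c hc
      rw [chainsFrom_append_left hu hv huv hb j hc, chainsFrom_append_left hu hv' huv' hb' j hc,
        h j (by omega)]
      congr 2
      exact List.map_congr_left fun d hd => by rw [ih (by omega) d hd]
  rw [chainCount_append hu hv huv hb, chainCount_append hu hv' huv' hb',
    List.map_congr_left fun c hc => by rw [hchains k le_rfl c hc]]
  ring

/-! ### The loop of a crossing as a segment of the word -/

section Split

variable {A I C : List GaussLetter} {c : GaussLetter}

theorem loopWeight_of_split (hw : IsGaussWord (A ++ [c] ++ I ++ [c.mate] ++ C)) :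
    (∀ x ∈ A, loopWeight (A ++ [c] ++ I ++ [c.mate] ++ C) c x = 0) ∧
    (∀ x ∈ I, loopWeight (A ++ [c] ++ I ++ [c.mate] ++ C) c x = 2) ∧
    (∀ x ∈ C, loopWeight (A ++ [c] ++ I ++ [c.mate] ++ C) c x = 0) := by
  have hnd := hw.nodup
  simp only [List.append_assoc] at hnd ⊢
  obtain ⟨-, h2, h3⟩ := List.nodup_append.1 hnd
  obtain ⟨-, h5, h6⟩ := List.nodup_append.1 h2
  obtain ⟨-, h8, h9⟩ := List.nodup_append.1 h5
  obtain ⟨-, -, h12⟩ := List.nodup_append.1 h8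
  have cA : c ∉ A := fun h => h3 c h c (by simp) rfl
  have mA : c.mate ∉ A := fun h => h3 _ h c.mate (by simp) rfl
  have cI : c ∉ I := fun h => h6 c (by simp) c (by simp [h]) rfl
  have mI : c.mate ∉ I := fun h => h9 _ h c.mate (by simp) rfl
  have mc : c.mate ∉ [c] := by simpa using c.mate_ne
  have hcm : side (A ++ ([c] ++ (I ++ ([c.mate] ++ C)))) c c.mate = 0 := by
    rw [side_append_right cA mA, side_append_lt (by simp) mc]
  refine ⟨fun x hx => ?_, fun x hx => ?_, fun x hx => ?_⟩
  · simp only [loopWeight, hcm, side_append_lt hx cA, side_append_lt hx mA]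
    ring
  · have xA : x ∉ A := fun h => h3 x h x (by simp [hx]) rfl
    have xc : x ∉ [c] := by simp only [List.mem_singleton]; rintro rfl; exact cI hx
    simp only [loopWeight, hcm]
    rw [side_append_right xA cA, side_append_gt xc (by simp), side_append_right xA mA,
      side_append_right xc mc, side_append_lt hx mI]
    ring
  · have xA : x ∉ A := fun h => h3 x h x (by simp [hx]) rfl
    have xc : x ∉ [c] := by
      simp only [List.mem_singleton]; rintro rfl; exact h6 x (by simp) x (by simp [hx]) rfl
    have xI : x ∉ I := fun h => h9 x h x (by simp [hx]) rfl
    have xm : x ∉ [c.mate] := by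
      simp only [List.mem_singleton]; rintro rfl; exact h12 _ (by simp) c.mate hx rfl
    simp only [loopWeight, hcm]
    rw [side_append_right xA cA, side_append_gt xc (by simp), side_append_right xA mA,
      side_append_right xc mc, side_append_right xI mI, side_append_gt xm (by simp)]
    ring

theorem loopWeight_mate (w : List GaussLetter) (c x : GaussLetter) :
    loopWeight w c.mate x = 2 - loopWeight w c x := by
  simp only [loopWeight, GaussLetter.mate_mate]
  rw [side_swap w c c.mate]
  ring

theorem loopWeight_self (w : List GaussLetter) (c : GaussLetter) : loopWeight w c c = 1 := by
  simp [loopWeight]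

theorem loopWeight_self_mate (w : List GaussLetter) (c : GaussLetter) :
    loopWeight w c c.mate = 1 := by
  simp only [loopWeight, side_self]
  rw [side_swap w c c.mate]
  ring

/-- The pairing with a loop, evaluated by running along the loop. -/
theorem pairing_loopWeight_of_split (hw : IsGaussWord (A ++ [c] ++ I ++ [c.mate] ++ C))
    (ψ : GaussLetter → ℤ) :
    pairing (A ++ [c] ++ I ++ [c.mate] ++ C) (loopWeight (A ++ [c] ++ I ++ [c.mate] ++ C) c) ψ =
      c.charge * (ψ c.mate - ψ c) + 2 * (I.map fun x => x.charge * ψ x.mate).sum := by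
  obtain ⟨hA, hI, hC⟩ := loopWeight_of_split hw
  have e1 := loopWeight_self (A ++ [c] ++ I ++ [c.mate] ++ C) c
  have e2 := loopWeight_self_mate (A ++ [c] ++ I ++ [c.mate] ++ C) c
  set W := A ++ [c] ++ I ++ [c.mate] ++ C
  have hzero : ∀ l : List GaussLetter, (∀ x ∈ l, loopWeight W c x = 0) →
      pairing l (loopWeight W c) ψ = 0 := by
    intro l hl
    refine List.sum_eq_zero fun y hy => ?_
    obtain ⟨x, hx, rfl⟩ := List.mem_map.1 hy
    rw [hl x hx]; ring
  have hIeq : pairing I (loopWeight W c) ψ = 2 * (I.map fun x => x.charge * ψ x.mate).sum := by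
    rw [pairing, ← List.sum_map_mul_left]
    congr 1
    refine List.map_congr_left fun x hx => ?_
    rw [hI x hx]; ring
  have h : pairing W (loopWeight W c) ψ = pairing A (loopWeight W c) ψ +
      pairing [c] (loopWeight W c) ψ + pairing I (loopWeight W c) ψ +
      pairing [c.mate] (loopWeight W c) ψ + pairing C (loopWeight W c) ψ := by
    conv_lhs => rw [show W = A ++ [c] ++ I ++ [c.mate] ++ C from rfl]
    simp only [pairing_append]
    rfl
  rw [h, hzero A hA, hzero C hC, hIeq]
  simp [pairing, e1, e2]
  ring

theorem loopInter_of_split {w : List GaussLetter} (hw : IsGaussWord w)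
    (h : w = A ++ [c] ++ I ++ [c.mate] ++ C) (d : GaussLetter) :
    loopInter w c d = c.charge * (loopWeight w d c.mate - loopWeight w d c) +
      2 * (I.map fun x => x.charge * loopWeight w d x.mate).sum := by
  subst h
  exact pairing_loopWeight_of_split hw _

theorem loopIndex_of_split {w : List GaussLetter} (hw : IsGaussWord w)
    (h : w = A ++ [c] ++ I ++ [c.mate] ++ C) :
    loopIndex w c = -2 * (I.map GaussLetter.charge).sum := by
  subst h
  rw [loopIndex, pairing_swap hw, pairing_loopWeight_of_split hw]
  simp

theorem loopIndex_mate {w : List GaussLetter} (hw : IsGaussWord w) (c : GaussLetter) :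
    loopIndex w c.mate = -loopIndex w c := by
  have h : pairing w (fun _ => 1) (fun x => loopWeight w c.mate x + loopWeight w c x) = 0 := by
    rw [← pairing_const_const hw 1 2]
    exact pairing_congr hw (fun _ _ => rfl) fun x _ => by rw [loopWeight_mate]; ring
  rw [pairing_add_right] at h
  unfold loopIndex
  omega

end Split

section VKWord

@[simp] theorem vkO_mate (i k : ℕ) : (vkO i k).mate = vkU i k := rfl

@[simp] theorem vkU_mate (i k : ℕ) : (vkU i k).mate = vkO i k := rfl

@[simp] theorem vkO_charge (i k : ℕ) : (vkO i k).charge = if vkSign k then 1 else -1 := by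
  cases h : vkSign k <;> simp [vkO, GaussLetter.charge, h]

@[simp] theorem vkU_charge (i k : ℕ) : (vkU i k).charge = if vkSign k then -1 else 1 := by
  cases h : vkSign k <;> simp [vkU, GaussLetter.charge, h]

/-- Block `i` of the word of `VK n`. -/
def vkBlock (n i : ℕ) : List GaussLetter :=
  vkBand i ++ (if i < n then [vkU (i + 1) 1, vkU (i + 1) 3] else []) ++ [vkU i 4, vkU i 2]

/-- The passages of block `0`, together with the passages of block `1` between them. -/
def vkBlockZero : List GaussLetter :=
  [vkU 0 5, vkU 0 6, vkU 1 1, vkU 1 3, vkO 0 6, vkO 0 5]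

/-- The word of `VK (m + 1)`, with the base point moved to the start of block `m + 1`. -/
def vkRotated (m : ℕ) : List GaussLetter := vkTail 1 m ++ vkBlockZero

theorem vkWord_succ (m : ℕ) : vkWord (m + 1) = vkBlockZero ++ vkTail 1 m := by
  simp [vkWord, vkBlockZero]

theorem vkTail_succ (i m : ℕ) : vkTail i (m + 1) = vkTail (i + 1) m ++ vkBlock (i + m + 1) i := by
  simp [vkTail, vkBlock]

theorem vkTail_zero (i : ℕ) : vkTail i 0 = vkBlock i i := by
  simp [vkTail, vkBlock]

theorem vkTail_split (m i j : ℕ) (hij : i ≤ j) (hj : j ≤ i + m) :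
    ∃ A C, vkTail i m = A ++ vkBlock (i + m) j ++ C ∧
      (j = i ∧ C = [] ∨ i < j ∧ ∃ C', C = vkBlock (i + m) (j - 1) ++ C') := by
  induction m generalizing i with
  | zero =>
    obtain rfl : i = j := by omega
    exact ⟨[], [], by simp [vkTail_zero], by simp⟩
  | succ m ih =>
    rw [vkTail_succ]
    rcases Nat.eq_or_lt_of_le hij with rfl | hlt
    · exact ⟨vkTail (i + 1) m, [], by simp [Nat.add_assoc], by simp⟩
    · obtain ⟨A, C, h, hC⟩ := ih (i + 1) hlt (by omega)
      have e : i + 1 + m = i + (m + 1) := by omega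
      rw [e] at h hC
      refine ⟨A, C ++ vkBlock (i + m + 1) i, by simp [h], Or.inr ⟨hlt, ?_⟩⟩
      rcases hC with ⟨rfl, rfl⟩ | ⟨-, C', rfl⟩
      · exact ⟨[], by simp [Nat.add_assoc]⟩
      · exact ⟨C' ++ vkBlock (i + m + 1) i, by simp⟩

theorem vkRotated_split {m j : ℕ} (h1 : 1 ≤ j) (hj : j ≤ m + 1) :
    ∃ A C, vkRotated m = A ++ vkBlock (m + 1) j ++
      (if j = 1 then vkBlockZero else vkBlock (m + 1) (j - 1)) ++ C := by
  obtain ⟨A, C, h, hC⟩ := vkTail_split m 1 j h1 (by omega)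
  rw [Nat.add_comm 1 m] at h hC
  rcases hC with ⟨rfl, rfl⟩ | ⟨hlt, C', rfl⟩
  · exact ⟨A, [], by simp [vkRotated, h]⟩
  · exact ⟨A, C' ++ vkBlockZero, by simp [vkRotated, h, hlt.ne']⟩

theorem vkRotated_isGaussWord (m : ℕ) : IsGaussWord (vkRotated m) :=
  (vkWord_isGaussWord (m + 1)).perm (by
    rw [vkWord_succ]; exact List.perm_append_comm)

end VKWord

/-! ### Indices of the crossings of `VK n` -/

section VKLoops

variable {m j : ℕ}

theorem vkRotated_split_one (h1 : 1 ≤ j) (hj : j ≤ m + 1) (h : j ≠ 1) :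
    ∃ A C, vkRotated m = A ++ [vkO j 1] ++ ([vkO j 5, vkO j 6, vkO j 3, vkO j 4] ++
      (if j < m + 1 then [vkU (j + 1) 1, vkU (j + 1) 3] else []) ++ [vkU j 4, vkU j 2] ++
      vkBand (j - 1)) ++ [(vkO j 1).mate] ++ C := by
  obtain ⟨A, C, e⟩ := vkRotated_split h1 hj
  obtain ⟨i, rfl⟩ : ∃ i, j = i + 1 := ⟨j - 1, by omega⟩
  refine ⟨A ++ [vkU (i + 1) 6, vkU (i + 1) 5, vkO (i + 1) 2],
    [vkU (i + 1) 3, vkU i 4, vkU i 2] ++ C, ?_⟩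
  have hi : i ≠ 0 := by omega
  have hi' : i < m + 1 := by omega
  rw [e]
  simp [vkBlock, vkBand, hi, hi']

theorem vkRotated_split_two (h1 : 1 ≤ j) (hj : j ≤ m + 1) :
    ∃ A C, vkRotated m = A ++ [vkO j 2] ++ ([vkO j 1, vkO j 5, vkO j 6, vkO j 3, vkO j 4] ++
      (if j < m + 1 then [vkU (j + 1) 1, vkU (j + 1) 3] else []) ++ [vkU j 4]) ++
      [(vkO j 2).mate] ++ C := by
  obtain ⟨A, C, e⟩ := vkRotated_split h1 hj
  refine ⟨A ++ [vkU j 6, vkU j 5],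
    (if j = 1 then vkBlockZero else vkBlock (m + 1) (j - 1)) ++ C, ?_⟩
  rw [e]
  simp [vkBlock, vkBand]

theorem vk_loopIndex_one (h1 : 1 ≤ j) (hj : j ≤ m + 1) :
    loopIndex (vkRotated m) (vkO j 1) = if j = 1 then 0 else -4 := by
  by_cases h : j = 1
  · subst h
    obtain ⟨A, C, e⟩ := vkRotated_split (m := m) le_rfl hj
    rw [loopIndex_of_split (vkRotated_isGaussWord m) (A := A ++ [vkU 1 6, vkU 1 5, vkO 1 2])
      (I := [vkO 1 5, vkO 1 6, vkO 1 3, vkO 1 4] ++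
        (if 1 < m + 1 then [vkU 2 1, vkU 2 3] else []) ++ [vkU 1 4, vkU 1 2, vkU 0 5, vkU 0 6])
      (C := [vkU 1 3, vkO 0 6, vkO 0 5] ++ C) (by rw [e]; simp [vkBlock, vkBand, vkBlockZero]),
      if_pos rfl]
    split_ifs <;> simp [vkSign]
  · obtain ⟨A, C, e⟩ := vkRotated_split_one h1 hj h
    rw [loopIndex_of_split (vkRotated_isGaussWord m) e]
    split_ifs <;> simp [vkSign, vkBand]

theorem vk_loopIndex_two (h1 : 1 ≤ j) (hj : j ≤ m + 1) :
    loopIndex (vkRotated m) (vkO j 2) = -4 := by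
  obtain ⟨A, C, e⟩ := vkRotated_split_two h1 hj
  rw [loopIndex_of_split (vkRotated_isGaussWord m) e]
  split_ifs <;> simp [vkSign]

theorem vk_loopIndex_three (h1 : 1 ≤ j) (hj : j ≤ m + 1) :
    loopIndex (vkRotated m) (vkO j 3) = if j = 1 then 4 else 0 := by
  obtain ⟨A, C, e⟩ := vkRotated_split h1 hj
  by_cases h : j = 1
  · subst h
    rw [loopIndex_of_split (vkRotated_isGaussWord m)
      (A := A ++ [vkU 1 6, vkU 1 5, vkO 1 2, vkO 1 1, vkO 1 5, vkO 1 6])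
      (I := [vkO 1 4] ++ (if 1 < m + 1 then [vkU 2 1, vkU 2 3] else []) ++
        [vkU 1 4, vkU 1 2, vkU 0 5, vkU 0 6, vkU 1 1])
      (C := [vkO 0 6, vkO 0 5] ++ C) (by rw [e]; simp [vkBlock, vkBand, vkBlockZero]),
      if_pos rfl]
    split_ifs <;> simp [vkSign]
  · obtain ⟨i, rfl⟩ : ∃ i, j = i + 1 := ⟨j - 1, by omega⟩
    have hi : i ≠ 0 := by omega
    have hi' : i < m + 1 := by omega
    rw [loopIndex_of_split (vkRotated_isGaussWord m)
      (A := A ++ [vkU (i + 1) 6, vkU (i + 1) 5, vkO (i + 1) 2, vkO (i + 1) 1, vkO (i + 1) 5,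
        vkO (i + 1) 6])
      (I := [vkO (i + 1) 4] ++
        (if i + 1 < m + 1 then [vkU (i + 1 + 1) 1, vkU (i + 1 + 1) 3] else []) ++
        [vkU (i + 1) 4, vkU (i + 1) 2] ++ vkBand i ++ [vkU (i + 1) 1])
      (C := [vkU i 4, vkU i 2] ++ C) (by rw [e]; simp [vkBlock, vkBand, hi, hi'])]
    split_ifs <;> simp [vkSign, vkBand]

theorem vk_loopIndex_four (h1 : 1 ≤ j) (hj : j ≤ m + 1) :
    loopIndex (vkRotated m) (vkO j 4) = 0 := by
  obtain ⟨A, C, e⟩ := vkRotated_split h1 hj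
  rw [loopIndex_of_split (vkRotated_isGaussWord m)
    (A := A ++ [vkU j 6, vkU j 5, vkO j 2, vkO j 1, vkO j 5, vkO j 6, vkO j 3])
    (I := if j < m + 1 then [vkU (j + 1) 1, vkU (j + 1) 3] else [])
    (C := [vkU j 2] ++ (if j = 1 then vkBlockZero else vkBlock (m + 1) (j - 1)) ++ C)
    (by rw [e]; simp [vkBlock, vkBand])]
  split_ifs <;> simp [vkSign]

theorem vk_loopIndex_five (h1 : 1 ≤ j) (hj : j ≤ m + 1) :
    loopIndex (vkRotated m) (vkO j 5) = 0 := by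
  obtain ⟨A, C, e⟩ := vkRotated_split h1 hj
  rw [← vkU_mate, loopIndex_mate (vkRotated_isGaussWord m),
    loopIndex_of_split (vkRotated_isGaussWord m) (A := A ++ [vkU j 6]) (I := [vkO j 2, vkO j 1])
      (C := [vkO j 6, vkO j 3, vkO j 4] ++
        (if j < m + 1 then [vkU (j + 1) 1, vkU (j + 1) 3] else []) ++ [vkU j 4, vkU j 2] ++
        (if j = 1 then vkBlockZero else vkBlock (m + 1) (j - 1)) ++ C)
      (by rw [e]; simp [vkBlock, vkBand])]
  simp [vkSign]

theorem vk_loopIndex_six (h1 : 1 ≤ j) (hj : j ≤ m + 1) :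
    loopIndex (vkRotated m) (vkO j 6) = 0 := by
  obtain ⟨A, C, e⟩ := vkRotated_split h1 hj
  rw [← vkU_mate, loopIndex_mate (vkRotated_isGaussWord m),
    loopIndex_of_split (vkRotated_isGaussWord m) (A := A)
      (I := [vkU j 5, vkO j 2, vkO j 1, vkO j 5])
      (C := [vkO j 3, vkO j 4] ++
        (if j < m + 1 then [vkU (j + 1) 1, vkU (j + 1) 3] else []) ++ [vkU j 4, vkU j 2] ++
        (if j = 1 then vkBlockZero else vkBlock (m + 1) (j - 1)) ++ C)
      (by rw [e]; simp [vkBlock, vkBand])]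
  simp [vkSign]

theorem vk_loopIndex_zero_five (m : ℕ) : loopIndex (vkRotated m) (vkO 0 5) = 0 := by
  rw [← vkU_mate, loopIndex_mate (vkRotated_isGaussWord m),
    loopIndex_of_split (vkRotated_isGaussWord m) (A := vkTail 1 m)
      (I := [vkU 0 6, vkU 1 1, vkU 1 3, vkO 0 6]) (C := [])
      (by simp [vkRotated, vkBlockZero])]
  simp [vkSign]

theorem vk_loopIndex_zero_six (m : ℕ) : loopIndex (vkRotated m) (vkO 0 6) = 0 := by
  rw [← vkU_mate, loopIndex_mate (vkRotated_isGaussWord m),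
    loopIndex_of_split (vkRotated_isGaussWord m) (A := vkTail 1 m ++ [vkU 0 5])
      (I := [vkU 1 1, vkU 1 3]) (C := [vkO 0 5])
      (by simp [vkRotated, vkBlockZero])]
  simp [vkSign]

end VKLoops

/-! ### Positions of the letters in `VK n` -/

section VKPositions

/-- Positions of the upper passages through the crossings `1, …, 6` within a block. -/
def vkOverPos : ℕ → ℤ
  | 1 => 4 | 2 => 3 | 3 => 7 | 4 => 8 | 5 => 5 | _ => 6

/-- Positions of the lower passages through the crossings `1, …, 6`, relative to the start of their
block. -/
def vkUnderPos : ℕ → ℤ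
  | 1 => 21 | 2 => 12 | 3 => 22 | 4 => 11 | 5 => 2 | _ => 1

/-- A labelling of the letters that increases along `vkRotated`. It decreases by `12` from each
block to the next one. -/
def vkPos (x : GaussLetter) : ℤ :=
  if x.crossing ≤ 6 then (if x.isOver then 17 - x.crossing else 2 + x.crossing)
  else -12 * (((x.crossing - 1) / 6 : ℕ) : ℤ) +
    (if x.isOver then vkOverPos ((x.crossing - 1) % 6 + 1)
      else vkUnderPos ((x.crossing - 1) % 6 + 1))

theorem vkPos_O {i k : ℕ} (hi : 1 ≤ i) (hk : 1 ≤ k) (hk' : k ≤ 6) :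
    vkPos (vkO i k) = -12 * (i : ℤ) + vkOverPos k := by
  have h1 : ¬ 6 * i + k ≤ 6 := by omega
  have h2 : (6 * i + k - 1) / 6 = i := by omega
  have h3 : (6 * i + k - 1) % 6 + 1 = k := by omega
  simp [vkPos, vkO, h1, h2, h3]

theorem vkPos_U {i k : ℕ} (hi : 1 ≤ i) (hk : 1 ≤ k) (hk' : k ≤ 6) :
    vkPos (vkU i k) = -12 * (i : ℤ) + vkUnderPos k := by
  have h1 : ¬ 6 * i + k ≤ 6 := by omega
  have h2 : (6 * i + k - 1) / 6 = i := by omega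
  have h3 : (6 * i + k - 1) % 6 + 1 = k := by omega
  simp [vkPos, vkU, h1, h2, h3]

theorem vkTail_sorted (m i : ℕ) (hi : 1 ≤ i) :
    (vkTail i m).Pairwise (fun x y => vkPos x < vkPos y) ∧
      ∀ x ∈ vkTail i m, vkPos x ≤ -12 * (i : ℤ) + 12 := by
  induction m generalizing i with
  | zero =>
    constructor
    · simp [vkTail, vkBand, vkPos_O hi, vkPos_U hi, vkOverPos, vkUnderPos]
    · simp [vkTail, vkBand, vkPos_O hi, vkPos_U hi, vkOverPos, vkUnderPos]
  | succ m ih =>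
    obtain ⟨ih1, ih2⟩ := ih (i + 1) (by omega)
    have hi' : 1 ≤ i + 1 := by omega
    push_cast at ih2
    have hblock : ∀ x ∈ vkBlock (i + m + 1) i,
        -12 * (i : ℤ) < vkPos x ∧ vkPos x ≤ -12 * (i : ℤ) + 12 := by
      have : i < i + m + 1 := by omega
      simp [vkBlock, this, vkBand, vkPos_O hi, vkPos_U hi, vkPos_U hi', vkOverPos,
        vkUnderPos]
      omega
    rw [vkTail_succ]
    refine ⟨List.pairwise_append.2 ⟨ih1, ?_, fun x hx y hy => ?_⟩, fun x hx => ?_⟩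
    · have : i < i + m + 1 := by omega
      simp [vkBlock, this, vkBand, vkPos_O hi, vkPos_U hi, vkPos_U hi', vkOverPos,
        vkUnderPos]
      omega
    · have := ih2 x hx
      have := (hblock y hy).1
      omega
    · rcases List.mem_append.1 hx with hx | hx
      · have := ih2 x hx
        omega
      · exact (hblock x hx).2

theorem vkRotated_sorted (m : ℕ) : (vkRotated m).Pairwise fun x y => vkPos x < vkPos y := by
  obtain ⟨h1, h2⟩ := vkTail_sorted m 1 le_rfl
  have hz : vkBlockZero.Pairwise fun x y => vkPos x < vkPos y := by
    simp [vkBlockZero, vkPos_U, vkUnderPos]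
    simp [vkPos, vkU, vkO]
  refine List.pairwise_append.2 ⟨h1, hz, fun x hx y hy => ?_⟩
  have := h2 x hx
  have h3 : ∀ y ∈ vkBlockZero, 0 < vkPos y := by
    simp [vkBlockZero, vkPos_U, vkUnderPos]
    simp [vkPos, vkU, vkO]
  have := h3 y hy
  push_cast at *
  omega

/-- The weight at `t` of the arc from `a` to `b`. -/
def arcWeight (a b t : ℤ) : ℤ :=
  if t < a then 0 else if t = a then 1 else if t < b then 2 else if t = b then 1 else 0

theorem arcWeight_add (a b t s : ℤ) : arcWeight (s + a) (s + b) (s + t) = arcWeight a b t := by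
  simp [arcWeight]

theorem vk_loopWeight {m : ℕ} {d x : GaussLetter} (hd : d ∈ vkRotated m) (hx : x ∈ vkRotated m)
    (h : vkPos d < vkPos d.mate) :
    loopWeight (vkRotated m) d x = arcWeight (vkPos d) (vkPos d.mate) (vkPos x) := by
  have hd' := (vkRotated_isGaussWord m).mate_mem d hd
  have hs := vkRotated_sorted m
  simp only [loopWeight, side_of_pairwise_lt hs hx hd, side_of_pairwise_lt hs hx hd',
    side_of_pairwise_lt hs hd hd', if_pos h, arcWeight]
  split_ifs <;> omega

end VKPositions

/-! ### Intersections of the loops of `VK n` -/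

section VKIntersections

variable {m : ℕ}

theorem vkRotated_perm (m : ℕ) :
    (vkRotated m).Perm ([vkO 0 5, vkU 0 5, vkO 0 6, vkU 0 6] ++ vkLetters 1 m) := by
  rw [List.perm_iff_count]
  intro a
  have h := (List.perm_iff_count.1 (vkTail_perm m 1)) a
  simp only [vkRotated, vkBlockZero, List.count_append, List.count_cons, List.count_nil] at h ⊢
  omega

theorem sum_vkLetters (g : GaussLetter → ℤ) (i m : ℕ) : ((vkLetters i m).map g).sum =
    ∑ p ∈ Finset.range (m + 1), ((vkBlockLetters (i + p)).map g).sum := by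
  induction m generalizing i with
  | zero => simp [vkLetters]
  | succ m ih =>
    rw [Finset.sum_range_succ', vkLetters, List.map_append, List.sum_append, ih, add_comm]
    simp only [Nat.add_zero, Nat.add_assoc, Nat.add_comm 1]

theorem vkBlockLetters_subset (i m p : ℕ) (hp : p ≤ m) :
    ∀ x ∈ vkBlockLetters (i + p), x ∈ vkLetters i m := by
  induction m generalizing i p with
  | zero => obtain rfl : p = 0 := by omega
            simp [vkLetters]
  | succ m ih =>
    intro x hx
    rw [vkLetters, List.mem_append]
    rcases p with _ | p
    · exact Or.inl hx
    · refine Or.inr (ih (i + 1) p (by omega) x ?_)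
      rwa [show i + 1 + p = i + (p + 1) by omega]

theorem vk_mem {j k : ℕ} (h1 : 1 ≤ j) (hj : j ≤ m + 1) (hk : 1 ≤ k) (hk' : k ≤ 6) :
    vkO j k ∈ vkRotated m ∧ vkU j k ∈ vkRotated m := by
  have hsub := vkBlockLetters_subset 1 m (j - 1) (by omega)
  rw [show 1 + (j - 1) = j by omega] at hsub
  have hmem : ∀ x ∈ vkBlockLetters j, x ∈ vkRotated m := fun x hx =>
    (vkRotated_perm m).mem_iff.2 (List.mem_append_right _ (hsub x hx))
  constructor <;> refine hmem _ ?_ <;> interval_cases k <;> simp [vkBlockLetters]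

/-- Four times the intersection number of the loops of two crossings of `VK (m + 1)` that have
number `1` or `2` in their blocks. It vanishes unless the blocks are neighbours. -/
theorem vk_loopInter {i j a b : ℕ} (hi : 1 ≤ i) (hij : i ≤ j) (hj : j ≤ m + 1)
    (ha : a = 1 ∧ i ≠ 1 ∨ a = 2) (hb : b = 1 ∨ b = 2) :
    loopInter (vkRotated m) (vkO i a) (vkO j b) = if b = 1 ∧ j = i + 1 then 8 else 0 := by
  have hj1 : 1 ≤ j := hi.trans hij
  have hb6 : 1 ≤ b ∧ b ≤ 6 := by omega
  obtain ⟨δ, rfl⟩ : ∃ δ, j = i + δ := ⟨j - i, by omega⟩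
  set A : ℤ := -12 * δ + vkOverPos b
  set B : ℤ := -12 * δ + vkUnderPos b
  have hdO := (vk_mem hj1 hj hb6.1 hb6.2).1
  have hlt : vkPos (vkO (i + δ) b) < vkPos (vkO (i + δ) b).mate := by
    rw [vkO_mate, vkPos_O hj1 hb6.1 hb6.2, vkPos_U hj1 hb6.1 hb6.2]
    rcases hb with rfl | rfl <;> simp [vkOverPos, vkUnderPos]
  have hval : ∀ x ∈ vkRotated m, ∀ t, vkPos x = -12 * (i : ℤ) + t →
      loopWeight (vkRotated m) (vkO (i + δ) b) x = arcWeight A B t := by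
    intro x hx t ht
    rw [vk_loopWeight hdO hx hlt, ht, vkO_mate, vkPos_O hj1 hb6.1 hb6.2, vkPos_U hj1 hb6.1 hb6.2,
      ← arcWeight_add A B t (-12 * (i : ℤ))]
    congr 1 <;> push_cast <;> ring
  -- the values of the loop weight on the letters of the blocks `i`, `i + 1` and `i - 1`
  have hO : ∀ k, 1 ≤ k → k ≤ 6 → loopWeight (vkRotated m) (vkO (i + δ) b) (vkO i k) =
      arcWeight A B (vkOverPos k) := fun k hk hk' =>
    hval _ (vk_mem hi (by omega) hk hk').1 _ (vkPos_O hi hk hk')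
  have hU : ∀ k, 1 ≤ k → k ≤ 6 → loopWeight (vkRotated m) (vkO (i + δ) b) (vkU i k) =
      arcWeight A B (vkUnderPos k) := fun k hk hk' =>
    hval _ (vk_mem hi (by omega) hk hk').2 _ (vkPos_U hi hk hk')
  have hO' : i < m + 1 → ∀ k, 1 ≤ k → k ≤ 6 →
      loopWeight (vkRotated m) (vkO (i + δ) b) (vkO (i + 1) k) =
      arcWeight A B (-12 + vkOverPos k) := fun h k hk hk' =>
    hval _ (vk_mem (by omega) (by omega) hk hk').1 _ (by
      rw [vkPos_O (by omega) hk hk']; push_cast; ring)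
  have hO'' : i ≠ 1 → ∀ k, 1 ≤ k → k ≤ 6 →
      loopWeight (vkRotated m) (vkO (i + δ) b) (vkO (i - 1) k) =
      arcWeight A B (12 + vkOverPos k) := fun h k hk hk' =>
    hval _ (vk_mem (m := m) (j := i - 1) (by omega) (by omega) hk hk').1 _ (by
      rw [vkPos_O (by omega) hk hk']; push_cast [hi]; ring)
  have hU'' : i ≠ 1 → ∀ k, 1 ≤ k → k ≤ 6 →
      loopWeight (vkRotated m) (vkO (i + δ) b) (vkU (i - 1) k) =
      arcWeight A B (12 + vkUnderPos k) := fun h k hk hk' =>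
    hval _ (vk_mem (m := m) (j := i - 1) (by omega) (by omega) hk hk').2 _ (by
      rw [vkPos_U (by omega) hk hk']; push_cast [hi]; ring)
  have hfar : 3 ≤ δ → ∀ t, -9 ≤ t → arcWeight A B t = 0 := by
    intro hδ t ht
    have h3 : (3 : ℤ) ≤ δ := by exact_mod_cast hδ
    have hA : A < t ∧ B < t := by
      constructor <;> rcases hb with rfl | rfl <;> simp only [A, B, vkOverPos, vkUnderPos] <;> omega
    unfold arcWeight
    split_ifs <;> omega
  -- the crossings of the next block contribute only if there is one
  have hR : i < m + 1 ∨ δ = 0 := by omega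
  have hsmall : δ = 0 ∨ δ = 1 ∨ δ = 2 ∨ 3 ≤ δ := by omega
  rcases ha with ⟨rfl, hi1⟩ | rfl
  · obtain ⟨X, Y, e⟩ := vkRotated_split_one (m := m) hi (by omega) hi1
    rw [loopInter_of_split (vkRotated_isGaussWord m) e]
    by_cases hlast : i < m + 1
    · simp only [hlast, if_true, vkBand, List.map_append, List.map_cons, List.map_nil,
        List.sum_append, List.sum_cons, List.sum_nil, vkO_mate, vkU_mate, vkO_charge, vkU_charge,
        vkSign, hO, hU, hO' hlast, hO'' hi1, hU'' hi1, Nat.reduceLeDiff]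
      rcases hsmall with rfl | rfl | rfl | hδ
      · rcases hb with rfl | rfl <;> simp [A, B, arcWeight, vkOverPos, vkUnderPos]
      · rcases hb with rfl | rfl <;> simp [A, B, arcWeight, vkOverPos, vkUnderPos]
      · rcases hb with rfl | rfl <;> simp [A, B, arcWeight, vkOverPos, vkUnderPos]
      · have : δ ≠ 1 := by omega
        simp [hfar hδ, vkOverPos, vkUnderPos, this]
    · obtain rfl : δ = 0 := hR.resolve_left hlast
      simp only [hlast, if_false, vkBand, List.map_append, List.map_cons, List.map_nil,
        List.sum_append, List.sum_cons, List.sum_nil, vkO_mate, vkU_mate, vkO_charge, vkU_charge,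
        vkSign, hO, hU, hO'' hi1, hU'' hi1, Nat.reduceLeDiff]
      rcases hb with rfl | rfl <;> simp [A, B, arcWeight, vkOverPos, vkUnderPos]
  · obtain ⟨X, Y, e⟩ := vkRotated_split_two (m := m) hi (by omega)
    rw [loopInter_of_split (vkRotated_isGaussWord m) e]
    by_cases hlast : i < m + 1
    · simp only [hlast, if_true, List.map_append, List.map_cons, List.map_nil,
        List.sum_append, List.sum_cons, List.sum_nil, vkO_mate, vkU_mate, vkO_charge, vkU_charge,
        vkSign, hO, hU, hO' hlast, Nat.reduceLeDiff]
      rcases hsmall with rfl | rfl | rfl | hδ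
      · rcases hb with rfl | rfl <;> simp [A, B, arcWeight, vkOverPos, vkUnderPos]
      · rcases hb with rfl | rfl <;> simp [A, B, arcWeight, vkOverPos, vkUnderPos]
      · rcases hb with rfl | rfl <;> simp [A, B, arcWeight, vkOverPos, vkUnderPos]
      · have : δ ≠ 1 := by omega
        simp [hfar hδ, vkOverPos, vkUnderPos, this]
    · obtain rfl : δ = 0 := hR.resolve_left hlast
      simp only [hlast, if_false, List.map_append, List.map_cons, List.map_nil,
        List.sum_append, List.sum_cons, List.sum_nil, vkO_mate, vkU_mate, vkO_charge, vkU_charge,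
        vkSign, hO, hU, Nat.reduceLeDiff]
      rcases hb with rfl | rfl <;> simp [A, B, arcWeight, vkOverPos, vkUnderPos]

end VKIntersections

/-! ### Chain counts of `VK n` -/

section VKChains

variable {m : ℕ}

theorem vk_crossingWeight_of_ne {c : GaussLetter} (h : loopIndex (vkRotated m) c ≠ -4) :
    crossingWeight (vkRotated m) c = 0 := by
  simp [crossingWeight, h]

theorem vk_crossingWeight_U (i k : ℕ) : crossingWeight (vkRotated m) (vkU i k) = 0 := by
  simp [crossingWeight, vkU]

theorem vk_crossingWeight_block {j : ℕ} (h1 : 1 ≤ j) (hj : j ≤ m + 1) (h : GaussLetter → ℤ) :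
    ((vkBlockLetters j).map fun d => crossingWeight (vkRotated m) d * h d).sum =
      (if j = 1 then 0 else h (vkO j 1)) - h (vkO j 2) := by
  have e1 : crossingWeight (vkRotated m) (vkO j 1) = if j = 1 then 0 else 1 := by
    rw [crossingWeight, vk_loopIndex_one h1 hj]
    split_ifs <;> simp_all [vkO, vkSign, GaussLetter.sgn]
  have e2 : crossingWeight (vkRotated m) (vkO j 2) = -1 := by
    rw [crossingWeight, vk_loopIndex_two h1 hj]
    simp [vkO, vkSign, GaussLetter.sgn]
  have e3 : crossingWeight (vkRotated m) (vkO j 3) = 0 :=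
    vk_crossingWeight_of_ne (by rw [vk_loopIndex_three h1 hj]; split_ifs <;> norm_num)
  have e4 : crossingWeight (vkRotated m) (vkO j 4) = 0 :=
    vk_crossingWeight_of_ne (by rw [vk_loopIndex_four h1 hj]; norm_num)
  have e5 : crossingWeight (vkRotated m) (vkO j 5) = 0 :=
    vk_crossingWeight_of_ne (by rw [vk_loopIndex_five h1 hj]; norm_num)
  have e6 : crossingWeight (vkRotated m) (vkO j 6) = 0 :=
    vk_crossingWeight_of_ne (by rw [vk_loopIndex_six h1 hj]; norm_num)
  simp only [vkBlockLetters, List.map_cons, List.map_nil, List.sum_cons, List.sum_nil,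
    vk_crossingWeight_U, e1, e2, e3, e4, e5, e6]
  split_ifs <;> ring

/-- Only the crossings `1` of the blocks `2, …, m + 1`, which are positive, and the crossings `2` of
the blocks `1, …, m + 1`, which are negative, are counted. -/
theorem vk_sum_crossingWeight (h : GaussLetter → ℤ) :
    ((vkRotated m).map fun d => crossingWeight (vkRotated m) d * h d).sum =
      ∑ p ∈ Finset.range (m + 1),
        ((if p = 0 then 0 else h (vkO (p + 1) 1)) - h (vkO (p + 1) 2)) := by
  have e5 : crossingWeight (vkRotated m) (vkO 0 5) = 0 :=
    vk_crossingWeight_of_ne (by rw [vk_loopIndex_zero_five]; norm_num)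
  have e6 : crossingWeight (vkRotated m) (vkO 0 6) = 0 :=
    vk_crossingWeight_of_ne (by rw [vk_loopIndex_zero_six]; norm_num)
  rw [((vkRotated_perm m).map _).sum_eq, List.map_append, List.sum_append, sum_vkLetters]
  simp only [List.map_cons, List.map_nil, List.sum_cons, List.sum_nil, vk_crossingWeight_U, e5, e6]
  simp only [zero_mul, zero_add]
  refine Finset.sum_congr rfl fun p hp => ?_
  have := Finset.mem_range.1 hp
  rw [vk_crossingWeight_block (by omega) (by omega), Nat.add_comm 1 p]
  simp

theorem vk_loopInter_iff {i j a b : ℕ} (hi : 1 ≤ i) (hi' : i ≤ m + 1) (hj : 1 ≤ j) (hj' : j ≤ m + 1)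
    (ha : a = 1 ∧ i ≠ 1 ∨ a = 2) (hb : b = 1 ∧ j ≠ 1 ∨ b = 2) :
    loopInter (vkRotated m) (vkO j b) (vkO i a) = -8 ↔ b = 1 ∧ j = i + 1 := by
  rcases le_total i j with h | h
  · rw [loopInter, pairing_swap (vkRotated_isGaussWord m), ← loopInter,
      vk_loopInter hi h hj' ha (by omega)]
    split_ifs with h1
    · simp [h1]
    · simp [h1]
  · rw [vk_loopInter hj h hi' hb (by omega)]
    have : ¬ (b = 1 ∧ j = i + 1) := by omega
    simp only [this, iff_false]
    split_ifs <;> norm_num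

theorem vk_chainsFrom_two (k j : ℕ) (h1 : 1 ≤ j) (hj : j ≤ m + 1) :
    chainsFrom (vkRotated m) (k + 1) (vkO j 2) = 0 := by
  rw [chainsFrom, vk_sum_crossingWeight]
  refine Finset.sum_eq_zero fun p hp => ?_
  have := Finset.mem_range.1 hp
  have e2 : loopInter (vkRotated m) (vkO j 2) (vkO (p + 1) 2) ≠ -8 := by
    rw [Ne, vk_loopInter_iff (by omega) (by omega) h1 hj (by omega) (by omega)]
    omega
  rw [if_neg e2]
  by_cases hp0 : p = 0
  · simp [hp0]
  · have e1 : loopInter (vkRotated m) (vkO j 2) (vkO (p + 1) 1) ≠ -8 := by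
      rw [Ne, vk_loopInter_iff (by omega) (by omega) h1 hj (by omega) (by omega)]
      omega
    rw [if_neg e1]
    simp

theorem vk_chainsFrom_one_succ (k p : ℕ) (hp : p + 2 ≤ m + 1) :
    chainsFrom (vkRotated m) (k + 1) (vkO (p + 2) 1) =
      (if p = 0 then 0 else chainsFrom (vkRotated m) k (vkO (p + 1) 1)) -
        chainsFrom (vkRotated m) k (vkO (p + 1) 2) := by
  have key : ∀ q < m + 1, ∀ a, (a = 1 ∧ q + 1 ≠ 1 ∨ a = 2) →
      (loopInter (vkRotated m) (vkO (p + 2) 1) (vkO (q + 1) a) = -8 ↔ q = p) := by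
    intro q hq a ha
    rw [vk_loopInter_iff (by omega) (by omega) (by omega) hp ha (by omega)]
    omega
  rw [chainsFrom, vk_sum_crossingWeight, Finset.sum_eq_single p]
  · rw [if_pos ((key p (by omega) 2 (by omega)).2 rfl)]
    by_cases hp0 : p = 0
    · simp [hp0]
    · rw [if_pos ((key p (by omega) 1 (by omega)).2 rfl)]
  · intro q hq hqp
    have hq := Finset.mem_range.1 hq
    rw [if_neg (mt (key q hq 2 (by omega)).1 hqp)]
    by_cases hq0 : q = 0
    · simp [hq0]
    · rw [if_neg (mt (key q hq 1 (by omega)).1 hqp)]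
      simp
  · intro h
    exact absurd (Finset.mem_range.2 (by omega)) h

/-- The chains from crossing `1` of block `p + 2` descend one block at each step. The two crossings
of each lower block cancel, except that in block `1` only the negative one is counted. -/
theorem vk_chainsFrom_one (k p : ℕ) (hp : p + 2 ≤ m + 1) :
    chainsFrom (vkRotated m) (k + 1) (vkO (p + 2) 1) = if p = k then -1 else 0 := by
  induction k generalizing p with
  | zero =>
    rw [vk_chainsFrom_one_succ 0 p hp]
    simp only [chainsFrom]
    split_ifs <;> simp
  | succ k ih =>
    rw [vk_chainsFrom_one_succ (k + 1) p hp, vk_chainsFrom_two k (p + 1) (by omega) (by omega)]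
    rcases p with _ | p
    · simp
    · rw [ih p (by omega)]
      simp

theorem vkRotated_chainCount (m k : ℕ) :
    chainCount (vkRotated m) k = if k < m + 1 then -1 else 0 := by
  rw [chainCount, vk_sum_crossingWeight, Finset.sum_range_succ']
  rcases k with _ | k
  · simp [chainsFrom]
  · have h : ∀ p ∈ Finset.range m,
        (if p + 1 = 0 then 0 else chainsFrom (vkRotated m) (k + 1) (vkO (p + 1 + 1) 1)) -
          chainsFrom (vkRotated m) (k + 1) (vkO (p + 1 + 1) 2) = if p = k then -1 else 0 := by
      intro p hp
      have := Finset.mem_range.1 hp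
      rw [vk_chainsFrom_two k (p + 1 + 1) (by omega) (by omega), vk_chainsFrom_one k p (by omega)]
      simp
    rw [Finset.sum_congr rfl h, vk_chainsFrom_two k (0 + 1) (by omega) (by omega)]
    simp

/-- The chain counts distinguish the knots `VK n`. -/
theorem vkWord_chainCount (n k : ℕ) : chainCount (vkWord n) k = if k < n then -1 else 0 := by
  rcases n with _ | m
  · simp [vkWord, chainCount]
  · rw [← vkRotated_chainCount, vkRotated, chainCount_rotate, ← vkWord_succ]
    rw [← vkWord_succ]
    exact vkWord_isGaussWord _

theorem exists_mem_vkBlockLetters {i m : ℕ} {x : GaussLetter} (hx : x ∈ vkLetters i m) :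
    ∃ p ≤ m, x ∈ vkBlockLetters (i + p) := by
  induction m generalizing i with
  | zero => exact ⟨0, le_rfl, hx⟩
  | succ m ih =>
    rcases List.mem_append.1 hx with hx | hx
    · exact ⟨0, by omega, hx⟩
    · obtain ⟨p, hp, h⟩ := ih hx
      exact ⟨p + 1, by omega, by rwa [show i + (p + 1) = i + 1 + p by omega]⟩

/-- The base point of `VK n` does not lie on any of the loops that are counted in chains: it lies on
the boundary of block `0`, and each of these loops runs within the blocks `1, …, n`. -/
theorem vkWord_avoidsBasePoint (n : ℕ) : AvoidsBasePoint (vkWord n) := by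
  rcases n with _ | m
  · intro d hd; simp [vkWord] at hd
  intro d hd hd0
  have hw := vkWord_isGaussWord (m + 1)
  rw [vkWord_succ] at hd hd0 hw ⊢
  have hcw : crossingWeight (vkBlockZero ++ vkTail 1 m) d = crossingWeight (vkRotated m) d := by
    rw [crossingWeight, crossingWeight, vkRotated, loopIndex_rotate hw hd]
  rw [hcw] at hd0
  have hperm := (vkRotated_perm m).mem_iff.1
    (List.perm_append_comm.mem_iff.1 hd : d ∈ vkRotated m)
  have main : ∀ j b, 1 ≤ j → j ≤ m + 1 → (b = 1 ∧ j ≠ 1 ∨ b = 2) → d = vkO j b →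
      side (vkBlockZero ++ vkTail 1 m) d d.mate = 0 := by
    rintro j b h1 hj hb rfl
    have hb6 : 1 ≤ b ∧ b ≤ 6 := by omega
    have hO : vkO j b ∉ vkBlockZero := by
      simp [vkBlockZero, vkO, vkU]; omega
    have hU : vkU j b ∉ vkBlockZero := by
      simp [vkBlockZero, vkO, vkU]; omega
    have hm := vk_mem h1 hj hb6.1 hb6.2
    have hO' := (List.mem_append.1 hm.1).resolve_right hO
    have hU' := (List.mem_append.1 hm.2).resolve_right hU
    rw [vkO_mate, side_append_right hO hU, ← side_append_left (v := vkBlockZero) hO' hU',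
      ← vkRotated, side_of_pairwise_lt (vkRotated_sorted m) hm.1 hm.2, if_pos]
    rw [vkPos_O h1 hb6.1 hb6.2, vkPos_U h1 hb6.1 hb6.2]
    rcases hb with ⟨rfl, -⟩ | rfl <;> simp [vkOverPos, vkUnderPos]
  obtain ⟨hover, hindex⟩ := (crossingWeight_eq_zero_or _ _).resolve_left hd0
  rcases List.mem_append.1 hperm with h | h
  · simp only [List.mem_cons, List.not_mem_nil, or_false] at h
    rcases h with rfl | rfl | rfl | rfl
    · simp [vk_loopIndex_zero_five] at hindex
    · simp [vkU] at hover
    · simp [vk_loopIndex_zero_six] at hindex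
    · simp [vkU] at hover
  · obtain ⟨p, hp, h⟩ := exists_mem_vkBlockLetters h
    have h1 : 1 ≤ 1 + p := by omega
    have hj : 1 + p ≤ m + 1 := by omega
    simp only [vkBlockLetters, List.mem_cons, List.not_mem_nil, or_false] at h
    rcases h with rfl | rfl | rfl | rfl | rfl | rfl | rfl | rfl | rfl | rfl | rfl | rfl
    · refine main _ 1 h1 hj (Or.inl ⟨rfl, fun h => ?_⟩) rfl
      rw [vk_loopIndex_one h1 hj, if_pos h] at hindex
      norm_num at hindex
    · simp [vkU] at hover
    · exact main _ 2 h1 hj (Or.inr rfl) rfl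
    · simp [vkU] at hover
    · rw [vk_loopIndex_three h1 hj] at hindex
      split_ifs at hindex
    · simp [vkU] at hover
    · rw [vk_loopIndex_four h1 hj] at hindex
      norm_num at hindex
    · simp [vkU] at hover
    · rw [vk_loopIndex_five h1 hj] at hindex
      norm_num at hindex
    · simp [vkU] at hover
    · rw [vk_loopIndex_six h1 hj] at hindex
      norm_num at hindex
    · simp [vkU] at hover

end VKChains

/-! ### Reducing a diagram by first and second Reidemeister moves -/

/-- Removal of a kink, or of two crossings by a second Reidemeister move, anywhere in a word. -/
inductive Cancel : List GaussLetter → List GaussLetter → Prop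
  | r1 (p q : List GaussLetter) (x : GaussLetter) : Cancel (p ++ [x, x.mate] ++ q) (p ++ q)
  | r2 (p q r : List GaussLetter) (e : Bool) (x y : GaussLetter) (hlevel : x.isOver = y.isOver)
      (hsign : x.isPos ≠ y.isPos) :
      Cancel (p ++ [x, y] ++ q ++ orderedPair e x.mate y.mate ++ r) (p ++ q ++ r)

/-- `w'` arises from `w` by finitely many removals of crossings. -/
abbrev Reduces : List GaussLetter → List GaussLetter → Prop := Relation.ReflTransGen Cancel

section Reduces

variable {w w' : List GaussLetter}

theorem Cancel.append (h : Cancel w w') (s t : List GaussLetter) :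
    Cancel (s ++ w ++ t) (s ++ w' ++ t) := by
  cases h with
  | r1 p q x => simpa using Cancel.r1 (s ++ p) (q ++ t) x
  | r2 p q r e x y hlevel hsign =>
    simpa using Cancel.r2 (s ++ p) q (r ++ t) e x y hlevel hsign

theorem Cancel.rename (h : Cancel w w') (f : ℕ → ℕ) :
    Cancel (w.map (GaussLetter.rename f)) (w'.map (GaussLetter.rename f)) := by
  cases h with
  | r1 p q x =>
    have h := Cancel.r1 (p.map (GaussLetter.rename f)) (q.map (GaussLetter.rename f)) (x.rename f)
    simpa using h
  | r2 p q r e x y hlevel hsign =>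
    have h := Cancel.r2 (p.map (GaussLetter.rename f)) (q.map (GaussLetter.rename f))
      (r.map (GaussLetter.rename f)) e (x.rename f) (y.rename f) hlevel hsign
    cases e <;> simpa [orderedPair] using h

theorem Reduces.append (h : Reduces w w') (s t : List GaussLetter) :
    Reduces (s ++ w ++ t) (s ++ w' ++ t) :=
  h.lift (fun l => s ++ l ++ t) fun _ _ h => h.append s t

theorem Reduces.rename (h : Reduces w w') (f : ℕ → ℕ) :
    Reduces (w.map (GaussLetter.rename f)) (w'.map (GaussLetter.rename f)) :=
  h.lift (List.map (GaussLetter.rename f)) fun _ _ h => h.rename f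

theorem GaussDiagram.knot_eq_of_step {D D' : GaussDiagram} (h : ReidemeisterStep D.word D'.word) :
    D.knot = D'.knot :=
  Quotient.sound (Relation.EqvGen.rel _ _ h)

theorem knot_eq_of_rotate {u v : List GaussLetter} (h : IsGaussWord (u ++ v))
    (h' : IsGaussWord (v ++ u)) :
    GaussDiagram.knot ⟨u ++ v, h⟩ = GaussDiagram.knot ⟨v ++ u, h'⟩ :=
  GaussDiagram.knot_eq_of_step (.rotate u v)

theorem Cancel.knot_eq (h : Cancel w w') (hw : IsGaussWord w) :
    ∃ hw' : IsGaussWord w', GaussDiagram.knot ⟨w, hw⟩ = GaussDiagram.knot ⟨w', hw'⟩ := by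
  cases h with
  | r1 p q x =>
    have h1 : IsGaussWord ([x, x.mate] ++ (q ++ p)) := hw.perm (by
      simpa using List.perm_append_comm (l₁ := p) (l₂ := [x, x.mate] ++ q))
    have h2 : IsGaussWord (q ++ p) := h1.of_perm_append (List.Perm.refl _) (by simp)
    refine ⟨h2.perm List.perm_append_comm, ?_⟩
    have e1 := GaussDiagram.knot_eq_of_step (D := ⟨_, h1⟩) (D' := ⟨_, h2⟩) (.r1 x (q ++ p))
    have e2 := knot_eq_of_rotate h2 (h2.perm List.perm_append_comm)
    have h3 : IsGaussWord (p ++ ([x, x.mate] ++ q)) := by simpa using hw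
    have h4 : IsGaussWord (([x, x.mate] ++ q) ++ p) := by simpa using h1
    have e3 := knot_eq_of_rotate h3 h4
    simp only [List.append_assoc] at e1 e2 e3 ⊢
    rw [e3, e1, e2]
  | r2 p q r e x y hlevel hsign =>
    have h1 : IsGaussWord ([x, y] ++ q ++ orderedPair e x.mate y.mate ++ (r ++ p)) := hw.perm (by
      simpa using List.perm_append_comm (l₁ := p)
        (l₂ := [x, y] ++ q ++ orderedPair e x.mate y.mate ++ r))
    have h2 : IsGaussWord (q ++ (r ++ p)) :=
      h1.of_perm_append (l := [x, y, x.mate, y.mate]) (by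
        have h1 := orderedPair_perm e x.mate y.mate
        rw [List.perm_iff_count]
        intro a
        have := (List.perm_iff_count.1 h1) a
        simp only [List.count_append, List.count_cons, List.count_nil] at this ⊢
        omega) (by simp)
    have h5 : IsGaussWord ((q ++ r) ++ p) := by simpa using h2
    have h6 : IsGaussWord (p ++ (q ++ r)) := h5.perm List.perm_append_comm
    refine ⟨by simpa using h6, ?_⟩
    have e1 := GaussDiagram.knot_eq_of_step (D := ⟨_, h1⟩) (D' := ⟨_, h2⟩)
      (.r2 e x y q (r ++ p) hlevel hsign)
    have e2 := knot_eq_of_rotate h5 h6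
    have h3 : IsGaussWord (p ++ ([x, y] ++ q ++ orderedPair e x.mate y.mate ++ r)) := by
      simpa using hw
    have h4 : IsGaussWord (([x, y] ++ q ++ orderedPair e x.mate y.mate ++ r) ++ p) := by
      simpa using h1
    have e3 := knot_eq_of_rotate h3 h4
    simp only [List.append_assoc] at e1 e2 e3 ⊢
    rw [e3, e1, e2]

theorem Reduces.knot_eq (h : Reduces w w') (hw : IsGaussWord w) :
    ∃ hw' : IsGaussWord w', GaussDiagram.knot ⟨w, hw⟩ = GaussDiagram.knot ⟨w', hw'⟩ := by
  induction h with
  | refl => exact ⟨hw, rfl⟩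
  | tail _ h ih =>
    obtain ⟨h1, e1⟩ := ih
    obtain ⟨h2, e2⟩ := h.knot_eq h1
    exact ⟨h2, e1.trans e2⟩

theorem Reduces.r1 (p q : List GaussLetter) (x : GaussLetter) :
    Reduces (p ++ [x, x.mate] ++ q) (p ++ q) := .single (.r1 p q x)

theorem Reduces.r2 (p q r : List GaussLetter) (e : Bool) (x y : GaussLetter)
    (hlevel : x.isOver = y.isOver) (hsign : x.isPos ≠ y.isPos) :
    Reduces (p ++ [x, y] ++ q ++ orderedPair e x.mate y.mate ++ r) (p ++ q ++ r) :=
  .single (.r2 p q r e x y hlevel hsign)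

end Reduces

section VKReduction

/-- The blocks `i, i + 1, …` come apart as soon as the strand through the crossings `1`, `3` of
block `i` can be brought next to them. -/
theorem vkTail_reduces (m i : ℕ) : Reduces (vkTail i m ++ [vkU i 1, vkU i 3]) [] := by
  induction m generalizing i with
  | zero =>
    have h1 : Reduces (vkTail i 0 ++ [vkU i 1, vkU i 3])
        [vkU i 6, vkU i 5, vkO i 2, vkO i 1, vkO i 5, vkO i 6, vkO i 3, vkU i 2, vkU i 1,
          vkU i 3] :=
      Reduces.r1 [vkU i 6, vkU i 5, vkO i 2, vkO i 1, vkO i 5, vkO i 6, vkO i 3]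
        [vkU i 2, vkU i 1, vkU i 3] (vkO i 4)
    have h2 := Reduces.r2 [vkU i 6, vkU i 5] [vkO i 5, vkO i 6, vkO i 3] [vkU i 3] true
      (vkO i 2) (vkO i 1) rfl (by simp [vkO, vkSign])
    have h3 := Reduces.r1 [vkU i 6] [vkO i 6, vkO i 3, vkU i 3] (vkU i 5)
    have h4 := Reduces.r1 [] [vkO i 3, vkU i 3] (vkU i 6)
    have h5 := Reduces.r1 [] [] (vkO i 3)
    exact h1.trans (h2.trans (h3.trans (h4.trans h5)))
  | succ m ih =>
    have h2 := Reduces.r2 [vkU i 6, vkU i 5]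
      [vkO i 5, vkO i 6, vkO i 3, vkO i 4, vkU (i + 1) 1, vkU (i + 1) 3, vkU i 4] [vkU i 3] true
      (vkO i 2) (vkO i 1) rfl (by simp [vkO, vkSign])
    have h3 := Reduces.r1 [vkU i 6]
      [vkO i 6, vkO i 3, vkO i 4, vkU (i + 1) 1, vkU (i + 1) 3, vkU i 4, vkU i 3] (vkU i 5)
    have h4 := Reduces.r1 []
      [vkO i 3, vkO i 4, vkU (i + 1) 1, vkU (i + 1) 3, vkU i 4, vkU i 3] (vkU i 6)
    have h5 := Reduces.r2 [] [vkU (i + 1) 1, vkU (i + 1) 3] [] false (vkO i 3) (vkO i 4) rfl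
      (by simp [vkO, vkSign])
    have h6 := Reduces.append (h2.trans (h3.trans (h4.trans h5))) (vkTail (i + 1) m) []
    have h7 : Reduces (vkTail i (m + 1) ++ [vkU i 1, vkU i 3])
        (vkTail (i + 1) m ++ [vkU (i + 1) 1, vkU (i + 1) 3]) := by
      simpa [vkTail, vkBand, orderedPair] using h6
    exact h7.trans (ih (i + 1))

/-- The part of `vkTail i m` that precedes the band of block `i`, and the part between this band and
the last two passages, cancel each other. -/
theorem vkTail_eq_reduces (m i : ℕ) : ∃ P R : List GaussLetter,
    vkTail i m = P ++ vkBand i ++ R ++ [vkU i 4, vkU i 2] ∧ Reduces (P ++ R) [] := by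
  cases m with
  | zero => exact ⟨[], [], by simp [vkTail], Relation.ReflTransGen.refl⟩
  | succ m =>
    exact ⟨vkTail (i + 1) m, [vkU (i + 1) 1, vkU (i + 1) 3], by simp [vkTail],
      vkTail_reduces m (i + 1)⟩

/-- The band of block `i` after the sign of crossing `5` has been reversed. -/
def vkFlippedBand (i : ℕ) : List GaussLetter :=
  [vkU i 6, (vkU i 5).flipSign, vkO i 2, vkO i 1, (vkO i 5).flipSign, vkO i 6, vkO i 3, vkO i 4]

theorem vkFlippedBand_reduces (i : ℕ) :
    Reduces (vkFlippedBand i) [vkO i 2, vkO i 1, vkO i 3, vkO i 4] :=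
  Reduces.r2 [] [vkO i 2, vkO i 1] [vkO i 3, vkO i 4] false (vkU i 6) (vkU i 5).flipSign rfl
    (by simp [vkU, vkSign, GaussLetter.flipSign])

/-- After the change of sign, block `i` and all later blocks disappear, whatever lies between them
and the strand through the crossings `1`, `3` of block `i`. -/
theorem vkFlippedTail_reduces (i : ℕ) {P R : List GaussLetter} (h : Reduces (P ++ R) [])
    (Q : List GaussLetter) :
    Reduces (P ++ vkFlippedBand i ++ R ++ [vkU i 4, vkU i 2] ++ Q ++ [vkU i 1, vkU i 3]) Q := by
  have h1 := (vkFlippedBand_reduces i).append P (R ++ [vkU i 4, vkU i 2] ++ Q ++ [vkU i 1, vkU i 3])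
  have h2 := Reduces.r2 (P ++ [vkO i 2]) ([vkO i 4] ++ R ++ [vkU i 4, vkU i 2] ++ Q) [] true
    (vkO i 1) (vkO i 3) rfl (by simp [vkO, vkSign])
  have h3 := Reduces.r2 P R Q false (vkO i 2) (vkO i 4) rfl (by simp [vkO, vkSign])
  have h4 := h.append [] Q
  simp only [List.append_assoc, List.cons_append, List.nil_append, orderedPair, vkO_mate,
    List.append_nil, if_true, Bool.false_eq_true, if_false] at h1 h2 h3 h4 ⊢
  exact h1.trans (h2.trans (h3.trans h4))

/-- The variant of `vkFlippedTail_reduces` for block `1`, where the strand through the crossings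
`1`, `3` comes first in the word. -/
theorem vkFlippedTail_reduces' (i : ℕ) {P R : List GaussLetter} (h : Reduces (P ++ R) [])
    (Q : List GaussLetter) :
    Reduces ([vkU i 1, vkU i 3] ++ Q ++ (P ++ vkFlippedBand i ++ R ++ [vkU i 4, vkU i 2])) Q := by
  have h1 := (vkFlippedBand_reduces i).append ([vkU i 1, vkU i 3] ++ Q ++ P)
    (R ++ [vkU i 4, vkU i 2])
  have h2 := Reduces.r2 [] (Q ++ P ++ [vkO i 2]) ([vkO i 4] ++ R ++ [vkU i 4, vkU i 2]) true
    (vkU i 1) (vkU i 3) rfl (by simp [vkU, vkSign])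
  have h3 := Reduces.r2 (Q ++ P) R [] false (vkO i 2) (vkO i 4) rfl (by simp [vkO, vkSign])
  have h4 := h.append Q []
  simp only [List.append_assoc, List.cons_append, List.nil_append, orderedPair, vkO_mate, vkU_mate,
    List.append_nil, if_true, Bool.false_eq_true, if_false] at h1 h2 h3 h4 ⊢
  exact h1.trans (h2.trans (h3.trans h4))

/-- The word of the blocks `i, …, i + j` arises from that of more blocks by deleting two segments:
the later blocks and the strand of block `i + j` through the crossings `1`, `3` of the next one. -/
theorem vkTail_add (j i k : ℕ) : ∃ X, vkTail i (j + 1 + k) =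
      vkTail (i + j + 1) k ++ vkBand (i + j) ++ [vkU (i + j + 1) 1, vkU (i + j + 1) 3] ++
        [vkU (i + j) 4, vkU (i + j) 2] ++ X ∧
    vkTail i j = vkBand (i + j) ++ [vkU (i + j) 4, vkU (i + j) 2] ++ X := by
  induction j generalizing i with
  | zero => exact ⟨[], by rw [Nat.zero_add, Nat.add_comm 1 k]; simp [vkTail], by simp [vkTail]⟩
  | succ j ih =>
    obtain ⟨X, h1, h2⟩ := ih (i + 1)
    rw [show i + 1 + j = i + (j + 1) by omega] at h1 h2
    refine ⟨X ++ (vkBand i ++ [vkU (i + 1) 1, vkU (i + 1) 3] ++ [vkU i 4, vkU i 2]), ?_, ?_⟩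
    · rw [show j + 1 + 1 + k = (j + 1 + k) + 1 by omega, vkTail, h1]
      simp
    · rw [vkTail, h2]
      simp

/-- Reversing the sign of one crossing of `VK n` gives a diagram that reduces to `VK m`. -/
theorem vkWord_flip_reduces {m n : ℕ} (h : m < n) : ∃ A B C : List GaussLetter,
    vkWord n = A ++ [vkU (m + 1) 5] ++ B ++ [(vkU (m + 1) 5).mate] ++ C ∧
    Reduces (A ++ [(vkU (m + 1) 5).flipSign] ++ B ++ [(vkU (m + 1) 5).mate.flipSign] ++ C)
      (vkWord m) := by
  rcases m with _ | j
  · obtain ⟨k, rfl⟩ : ∃ k, n = k + 1 := ⟨n - 1, by omega⟩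
    obtain ⟨P, R, e, hPR⟩ := vkTail_eq_reduces k 1
    refine ⟨[vkU 0 5, vkU 0 6] ++ [vkU 1 1, vkU 1 3] ++ [vkO 0 6, vkO 0 5] ++ P ++ [vkU 1 6],
      [vkO 1 2, vkO 1 1], [vkO 1 6, vkO 1 3, vkO 1 4] ++ R ++ [vkU 1 4, vkU 1 2], ?_, ?_⟩
    · simp [vkWord, e, vkBand]
    · have h1 := (vkFlippedTail_reduces' 1 hPR [vkO 0 6, vkO 0 5]).append [vkU 0 5, vkU 0 6] []
      have h2 := Reduces.r1 [vkU 0 5] [vkO 0 5] (vkU 0 6)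
      have h3 := Reduces.r1 [] [] (vkU 0 5)
      simp only [List.append_assoc, List.cons_append, List.nil_append, List.append_nil, vkU_mate,
        vkFlippedBand] at h1 h2 h3 ⊢
      exact h1.trans (h2.trans h3)
  · obtain ⟨k, rfl⟩ : ∃ k, n = j + 1 + k + 1 := ⟨n - j - 2, by omega⟩
    obtain ⟨X, e1, e2⟩ := vkTail_add j 1 k
    obtain ⟨P, R, e, hPR⟩ := vkTail_eq_reduces k (1 + j + 1)
    rw [e] at e1
    rw [show 1 + j = j + 1 by omega] at e1 e2
    refine ⟨[vkU 0 5, vkU 0 6] ++ [vkU 1 1, vkU 1 3] ++ [vkO 0 6, vkO 0 5] ++ P ++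
        [vkU (j + 1 + 1) 6], [vkO (j + 1 + 1) 2, vkO (j + 1 + 1) 1],
      [vkO (j + 1 + 1) 6, vkO (j + 1 + 1) 3, vkO (j + 1 + 1) 4] ++ R ++
        [vkU (j + 1 + 1) 4, vkU (j + 1 + 1) 2] ++ vkBand (j + 1) ++
        [vkU (j + 1 + 1) 1, vkU (j + 1 + 1) 3] ++ [vkU (j + 1) 4, vkU (j + 1) 2] ++ X, ?_, ?_⟩
    · simp [vkWord, e1, vkBand]
    · have h1 := (vkFlippedTail_reduces (j + 1 + 1) hPR (vkBand (j + 1))).append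
        ([vkU 0 5, vkU 0 6] ++ [vkU 1 1, vkU 1 3] ++ [vkO 0 6, vkO 0 5])
        ([vkU (j + 1) 4, vkU (j + 1) 2] ++ X)
      simp only [vkWord, e2, List.append_assoc, List.cons_append, List.nil_append, vkU_mate,
        vkFlippedBand] at h1 ⊢
      exact h1

end VKReduction

/-! ### Arc shifts and the simplex -/

namespace GaussLetter

theorem flipSign_flipSign (x : GaussLetter) : x.flipSign.flipSign = x := by
  simp [flipSign]

theorem flipAlong_singleton (x y : GaussLetter) :
    flipAlong [x] y = if x.crossing = y.crossing then y.flipSign else y := by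
  by_cases h : x.crossing = y.crossing <;> simp [flipAlong, h]

theorem flipAlong_crossing (s : List GaussLetter) (x : GaussLetter) :
    (flipAlong s x).crossing = x.crossing := by
  unfold flipAlong; split_ifs <;> rfl

theorem flipAlong_mate (s : List GaussLetter) (x : GaussLetter) :
    (flipAlong s x).mate = flipAlong s x.mate := by
  by_cases h : Odd (s.countP fun y => y.crossing = x.crossing)
  · rw [flipAlong, if_pos h, flipAlong, if_pos (by exact h)]
    rfl
  · rw [flipAlong, if_neg h, flipAlong, if_neg (by exact h)]

theorem flipAlong_flipAlong (s : List GaussLetter) (x : GaussLetter) :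
    flipAlong s (flipAlong s x) = x := by
  by_cases h : Odd (s.countP fun y => y.crossing = x.crossing)
  · have h1 : flipAlong s x = x.flipSign := if_pos h
    rw [h1, show flipAlong s x.flipSign = x.flipSign.flipSign from if_pos h, flipSign_flipSign]
  · have h1 : flipAlong s x = x := if_neg h
    rw [h1, h1]

theorem flipAlong_injective (s : List GaussLetter) : Function.Injective (flipAlong s) :=
  Function.Involutive.injective (flipAlong_flipAlong s)

end GaussLetter

open GaussLetter in
theorem IsGaussWord.flipAlong {w : List GaussLetter} (hw : IsGaussWord w) (s : List GaussLetter) :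
    IsGaussWord (w.map (GaussLetter.flipAlong s)) where
  nodup := hw.nodup.map (flipAlong_injective s)
  mate_mem := by
    intro x hx
    obtain ⟨y, hy, rfl⟩ := List.mem_map.1 hx
    exact List.mem_map.2 ⟨y.mate, hw.mate_mem y hy, (flipAlong_mate s y).symm⟩
  eq_or_eq_mate := by
    intro x hx y hy h
    obtain ⟨x, hx₀, rfl⟩ := List.mem_map.1 hx
    obtain ⟨y, hy₀, rfl⟩ := List.mem_map.1 hy
    rw [flipAlong_crossing, flipAlong_crossing] at h
    rcases hw.eq_or_eq_mate x hx₀ y hy₀ h with rfl | rfl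
    · exact Or.inl rfl
    · exact Or.inr (flipAlong_mate s x).symm

/-- The diagram in which the sign of the crossing of `x` is reversed. -/
def GaussDiagram.flip (D : GaussDiagram) (x : GaussLetter) : GaussDiagram :=
  ⟨D.word.map (GaussLetter.flipAlong [x]), D.isGaussWord.flipAlong [x]⟩

/-- An arc with a single classical passage gives an arc shift that reverses the sign of a
crossing. -/
theorem GaussDiagram.arcShift_flip (D : GaussDiagram) {x : GaussLetter} (hx : x ∈ D.word) :
    ArcShift D (D.flip x) ∧ ArcShift (D.flip x) D := by
  obtain ⟨A, B, e⟩ := List.append_of_mem hx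
  have hrot : D.word.IsRotated ([x] ++ (B ++ A)) := by
    rw [e]
    simpa using List.isRotated_append (l := A) (l' := x :: B)
  have hflip : GaussLetter.flipAlong [GaussLetter.flipAlong [x] x] = GaussLetter.flipAlong [x] := by
    funext y
    simp only [GaussLetter.flipAlong_singleton, if_true]
    rfl
  refine ⟨⟨[x], B ++ A, by simp, hrot, hrot.map _⟩,
    ⟨[GaussLetter.flipAlong [x] x], (B ++ A).map (GaussLetter.flipAlong [x]), by simp, ?_, ?_⟩⟩
  · simpa [GaussDiagram.flip] using hrot.map (GaussLetter.flipAlong [x])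
  · rw [hflip]
    have h : ∀ l : List GaussLetter,
        (l.map (GaussLetter.flipAlong [x])).map (GaussLetter.flipAlong [x]) = l := by
      intro l
      simp [Function.comp_def, GaussLetter.flipAlong_flipAlong]
    have h2 := h ([x] ++ (B ++ A))
    simp only [List.map_append, List.map_cons, List.map_nil] at h2
    simp only [List.reverse_singleton, List.map_append, List.map_cons, List.map_nil]
    rw [h2]
    exact hrot

theorem map_flipAlong_of_ne {x : GaussLetter} {l : List GaussLetter}
    (h : ∀ y ∈ l, x.crossing ≠ y.crossing) : l.map (GaussLetter.flipAlong [x]) = l := by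
  refine (List.map_congr_left fun y hy => ?_).trans (List.map_id l)
  simp [GaussLetter.flipAlong_singleton, h y hy]

theorem map_flipAlong_of_split {A B C : List GaussLetter} {x : GaussLetter}
    (hw : IsGaussWord (A ++ [x] ++ B ++ [x.mate] ++ C)) :
    (A ++ [x] ++ B ++ [x.mate] ++ C).map (GaussLetter.flipAlong [x]) =
      A ++ [x.flipSign] ++ B ++ [x.mate.flipSign] ++ C := by
  have hperm : (A ++ [x] ++ B ++ [x.mate] ++ C).Perm ([x, x.mate] ++ (A ++ B ++ C)) := by
    rw [List.perm_iff_count]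
    intro a
    simp only [List.count_append, List.count_cons, List.count_nil]
    omega
  have hnd := hperm.nodup_iff.1 hw.nodup
  have h : ∀ y ∈ A ++ B ++ C, x.crossing ≠ y.crossing := by
    intro y hy e
    have hne := fun z hz => (List.nodup_append.1 hnd).2.2 z hz y hy
    have hyw := hperm.mem_iff.2 (List.mem_append_right _ hy)
    rcases hw.eq_or_eq_mate x (by simp) y hyw e.symm with rfl | rfl
    · exact hne y (by simp) rfl
    · exact hne x.mate (by simp) rfl
  simp only [List.map_append, List.map_cons, List.map_nil, GaussLetter.flipAlong_singleton,
    GaussLetter.mate_crossing, if_true]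
  rw [map_flipAlong_of_ne fun y hy => h y (by simp [hy]),
    map_flipAlong_of_ne fun y hy => h y (by simp [hy]),
    map_flipAlong_of_ne fun y hy => h y (by simp [hy])]

section ConnectedSum

variable (D : GaussDiagram)

theorem connectedSum_crossing_ne (D' : GaussDiagram) :
    ∀ x ∈ D.word.map (GaussLetter.rename fun k => 2 * k),
      ∀ y ∈ D'.word.map (GaussLetter.rename fun k => 2 * k + 1), x.crossing ≠ y.crossing := by
  intro x hx y hy
  obtain ⟨x, -, rfl⟩ := List.mem_map.1 hx
  obtain ⟨y, -, rfl⟩ := List.mem_map.1 hy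
  simp only [GaussLetter.rename]
  omega

theorem connectedSum_arcShiftAdj {m n : ℕ} (h : m < n) :
    ArcShiftAdj (D.connectedSum (vkDiagram n)).knot (D.connectedSum (vkDiagram m)).knot ∧
    ArcShiftAdj (D.connectedSum (vkDiagram m)).knot (D.connectedSum (vkDiagram n)).knot := by
  obtain ⟨A, B, C, e, hred⟩ := vkWord_flip_reduces h
  set ρ : GaussLetter → GaussLetter := GaussLetter.rename fun k => 2 * k + 1 with hρ
  set x := vkU (m + 1) 5
  set E := D.connectedSum (vkDiagram n)
  have hxE : ρ x ∈ E.word :=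
    List.mem_append_right _ (List.mem_map.2 ⟨x, by simp [vkDiagram, e], rfl⟩)
  have hflip : ∀ y, GaussLetter.flipAlong [ρ x] (ρ y) = ρ (GaussLetter.flipAlong [x] y) := by
    intro y
    have hc : (ρ x).crossing = (ρ y).crossing ↔ x.crossing = y.crossing := by
      simp only [hρ, GaussLetter.rename]
      omega
    simp only [GaussLetter.flipAlong_singleton, hc]
    split_ifs <;> rfl
  have hword : (E.flip (ρ x)).word = D.word.map (GaussLetter.rename fun k => 2 * k) ++
      (A ++ [x.flipSign] ++ B ++ [x.mate.flipSign] ++ C).map ρ := by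
    rw [← map_flipAlong_of_split (e ▸ vkWord_isGaussWord n), ← e]
    change List.map _ (_ ++ _) = _
    rw [List.map_append, map_flipAlong_of_ne, List.map_map, List.map_map]
    · congr 1
      exact List.map_congr_left fun y _ => hflip y
    · intro y hy he
      obtain ⟨z, -, rfl⟩ := List.mem_map.1 hy
      simp only [hρ, GaussLetter.rename] at he
      omega
  have hknot : (E.flip (ρ x)).knot = (D.connectedSum (vkDiagram m)).knot := by
    have h1 := Reduces.append (hred.rename fun k => 2 * k + 1)
      (D.word.map (GaussLetter.rename fun k => 2 * k)) []
    rw [List.append_nil, List.append_nil, ← hρ, ← hword] at h1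
    obtain ⟨_, h2⟩ := h1.knot_eq (E.flip (ρ x)).isGaussWord
    exact h2
  obtain ⟨h1, h2⟩ := E.arcShift_flip hxE
  exact ⟨⟨E, _, rfl, hknot, h1⟩, ⟨_, E, hknot, rfl, h2⟩⟩

theorem AvoidsBasePoint.rename {v : List GaussLetter} (hb : AvoidsBasePoint v) {f : ℕ → ℕ}
    (hf : Function.Injective f) : AvoidsBasePoint (v.map (GaussLetter.rename f)) := by
  intro d hd hd0
  obtain ⟨d, hdv, rfl⟩ := List.mem_map.1 hd
  rw [GaussLetter.rename_mate, side_map (GaussLetter.rename_injective hf)]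
  refine hb d hdv fun h => hd0 ?_
  rw [crossingWeight] at h ⊢
  rwa [loopIndex_rename hf]

theorem connectedSum_knot_ne {m n : ℕ} (h : m < n) :
    (D.connectedSum (vkDiagram m)).knot ≠ (D.connectedSum (vkDiagram n)).knot := by
  intro he
  have h2 : Function.Injective fun k : ℕ => 2 * k := fun a b h => by simpa using h
  have h3 : Function.Injective fun k : ℕ => 2 * k + 1 := fun a b h => by simpa using h
  have hcount := chainCount_eq_of_knot_eq he m
  have hsub := chainCount_append_sub (D.isGaussWord.rename h2)
    ((vkWord_isGaussWord m).rename h3) ((vkWord_isGaussWord n).rename h3)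
    (connectedSum_crossing_ne D (vkDiagram m)) (connectedSum_crossing_ne D (vkDiagram n))
    ((vkWord_avoidsBasePoint m).rename h3) ((vkWord_avoidsBasePoint n).rename h3) (k := m) (by
      intro j hj
      rw [chainCount_rename h3, chainCount_rename h3, vkWord_chainCount, vkWord_chainCount,
        if_pos hj, if_pos (hj.trans h)])
  rw [chainCount_rename h3, chainCount_rename h3, vkWord_chainCount, vkWord_chainCount,
    if_neg (lt_irrefl m), if_pos h] at hsub
  change chainCount (D.connectedSum (vkDiagram m)).word m -
    chainCount (D.connectedSum (vkDiagram n)).word m = _ at hsub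
  rw [hcount] at hsub
  norm_num at hsub

theorem connectedSum_vkDiagram_zero : (D.connectedSum (vkDiagram 0)).knot = D.knot := by
  have h2 : Function.Injective fun k : ℕ => 2 * k := fun a b h => by simpa using h
  refine (GaussDiagram.knot_eq_of_step ?_).symm
  have h : (D.connectedSum (vkDiagram 0)).word =
      D.word.map (GaussLetter.rename fun k => 2 * k) := by
    simp [GaussDiagram.connectedSum, vkDiagram, vkWord]
  rw [h]
  exact .rename _ h2 _

end ConnectedSum

theorem arcShiftDist_eq_one {K K' : VirtualKnot} (hne : K ≠ K') (h : ArcShiftAdj K K') :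
    arcShiftDist K K' = 1 := by
  refine le_antisymm ?_ ?_
  · refine iInf₂_le_of_le 1 ⟨fun i => if i = 0 then K else K', rfl, rfl, ?_⟩ (by simp)
    intro i hi
    obtain rfl : i = 0 := by omega
    exact h
  · refine le_iInf₂ fun m hm => ?_
    obtain ⟨c, h0, hm, -⟩ := hm
    have : m ≠ 0 := by
      rintro rfl
      exact hne (h0.symm.trans hm)
    exact_mod_cast Nat.one_le_iff_ne_zero.2 this

theorem vkSumVertices_isSimplex (D : GaussDiagram) (n : ℕ) :
    IsSimplexOfDim arcShiftGordianComplex n (vkSumVertices D n) := by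
  classical
  have hinj : Function.Injective fun i => (D.connectedSum (vkDiagram i)).knot := by
    intro i j hij
    rcases lt_trichotomy i j with h | h | h
    · exact absurd hij (connectedSum_knot_ne D h)
    · exact h
    · exact absurd hij.symm (connectedSum_knot_ne D h)
  refine ⟨⟨?_, fun K hK K' hK' hne => arcShiftDist_eq_one hne ?_⟩, ?_⟩
  · exact (Finset.nonempty_range_iff.2 (Nat.succ_ne_zero n)).image _
  · obtain ⟨i, -, rfl⟩ := Finset.mem_image.1 hK
    obtain ⟨j, -, rfl⟩ := Finset.mem_image.1 hK'
    rcases lt_trichotomy i j with h | rfl | h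
    · exact (connectedSum_arcShiftAdj D h).2
    · exact absurd rfl hne
    · exact (connectedSum_arcShiftAdj D h).1
  · rw [vkSumVertices, Finset.card_image_of_injective _ hinj, Finset.card_range]

theorem corollary3p3 (L : VirtualKnot) (n : ℕ) (hn : 1 ≤ n) :
    (∃ σ : Finset VirtualKnot, IsSimplexOfDim arcShiftGordianComplex n σ ∧ L ∈ σ) ∧
    ∀ D : GaussDiagram, D.knot = L →
      IsSimplexOfDim arcShiftGordianComplex n (vkSumVertices D n) ∧
      (D.connectedSum (vkDiagram 0)).knot = L ∧ L ∈ vkSumVertices D n := by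
  have h : ∀ D : GaussDiagram, D.knot = L →
      IsSimplexOfDim arcShiftGordianComplex n (vkSumVertices D n) ∧
      (D.connectedSum (vkDiagram 0)).knot = L ∧ L ∈ vkSumVertices D n := by
    intro D hD
    have h0 : (D.connectedSum (vkDiagram 0)).knot = L := (connectedSum_vkDiagram_zero D).trans hD
    classical
    exact ⟨vkSumVertices_isSimplex D n, h0, Finset.mem_image.2 ⟨0, by simp, h0⟩⟩
  obtain ⟨D, hD⟩ : ∃ D : GaussDiagram, D.knot = L := Quotient.exists_rep L
  exact ⟨⟨vkSumVertices D n, (h D hD).1, (h D hD).2.2⟩, h⟩
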